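/- **Setting.** Let $K$ be a locally compact metric space, $\mu$ a Radon measure on $K$ with full support, and $(\mathcal E,\mathcal F)$ a Dirichlet form on $L^2(K,\mu)$ (densely defined, closed, symmetric, non-negative definite, Markovian) which is regular, i.e. $\mathcal C:=C_c(K)\cap\mathcal F$ is uniformly dense in $C_c(K)$ and dense in $\mathcal F$ for $\mathcal E_1(f,g)=\mathcal E(f,g)+\langle f,g\rangle_{L^2}$, and strongly local, i.e. $\mathcal E(u,v)=0$ whenever $u\in\mathcal F$ is constant on a neighbourhood of the support of $v\in\mathcal F$. For $f,g,\varphi\in\mathcal C$ put $\int\varphi\,d\Gamma(f,g)=\frac12\big(\mathcal E(\varphi f,g)+\mathcal E(\varphi g,f)-\mathcal E(\varphi,fg)\big)$ (energy measures). Let $\mathcal H$ be the Hilbert space obtained from $\mathcal C\otimes\mathcal C$ with $\langle a\otimes b,c\otimes d\rangle_{\mathcal H}=\int bd\,d\Gamma(a,c)$ by factoring out the null space and completing. Let $\Phi=(\varphi^1,\dots,\varphi^m):K\to\mathbb R^m$ be a coordinate sequence: $\varphi^i\in\mathcal C$; the densities $Z^{ij}=d\Gamma(\varphi^i,\varphi^j)/d\mu$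 exist and lie in $L^1(K,\mu)\cap L^\infty(K,\mu)$; and $C^1(\Phi)=\{F\circ\Phi: F\in C^1_0(\mathbb R^m)\}$ is an $\mathcal E_1$-dense subspace of $\mathcal C$ (this forces $K$ to be compact). Let $K_\Phi=\Phi(K)$, $\tilde\mu=\Phi_*\mu$, and let $U\subseteq\mathbb R^m$ be open with $K_\Phi\subseteq U$. For an open set $V\subseteq\mathbb R^m$ let $C^1_0(V)$ be the set of functions in $C_0(\overline V)$ that are $C^1$ on $V$ with bounded first derivatives. Let $\Omega^1_C(U)$ be the space of forms $\omega=\sum_i\omega_i\,dx^i$ with $\omega_i\in C_0(\overline U)$, with norm $\sup_p(\sum_i\omega_i(p)^2)^{1/2}$. Let $\mathcal I_{K_\Phi}=\{f\in C^1_0(U): f|_{K_\Phi}=0\}$ and, for $p\in K_\Phi$, $T^*_pK_\Phi=T^*_pU/d_p\mathcal I_{K_\Phi}$ with the quotient Hilbert norm of $T_p^*U=\mathbb R^m$. Let $\rho$ send $\omega\in\Omega^1_C(U)$ to the section $\rho\omega: p\mapsto[\omega_p]$ of $T^*K_\Phi$, let $\Omega^1_C(K_\Phi)$ be the image of $\rho$,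 and let $\Omega^1_{L^2}(K_\Phi)=\int^\oplus T^*_pK_\Phi\,d\tilde\mu(p)$. **Theorem.** $\mathcal C$ is an algebra and $\langle\cdot,\cdot\rangle_{\mathcal H}$ is a well-defined semi-inner product. For $a\in\mathcal C$ and $b\in C(K)$ there are functions in $\mathcal C$ arbitrarily uniformly close to $b$, and $a\otimes b:=\lim a\otimes b'$ exists in $\mathcal H$ as $b'\in\mathcal C$, $b'\to b$ uniformly. The map $$\pi:\Omega^1_C(U)\to\mathcal H,\qquad \pi\Big(\sum_i\omega_i\,dx^i\Big)=\sum_i\varphi^i\otimes(\omega_i\circ\Phi)$$ is linear and continuous, and: 1. $\pi$ induces an injective linear map of $\mathcal N=\Omega^1_C(U)/\ker\pi$ onto a dense subspace of $\mathcal H$. 2. $\ker\rho\subseteq\ker\pi$ (every $\omega$ with $\omega_p\in d_p\mathcal I_{K_\Phi}$ for all $p\in K_\Phi$ lies in $\ker\pi$), so $\pi$ descends to a linear map $\tilde\pi:\Omega^1_C(K_\Phi)\to\mathcal H$ with $\tilde\pi(\rho\omega)=\sum_i\varphi^i\otimes(\omega_i\circ\Phi)$ for $\omega=\sum_i\omega_i\,dx^i$.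 3. Every section in $\Omega^1_C(K_\Phi)$ defines an element of $\Omega^1_{L^2}(K_\Phi)$, and $\pi$ induces a well-defined linear operator from $\Omega^1_{L^2}(K_\Phi)$ to $\mathcal H$ whose domain is the image of $\Omega^1_C(K_\Phi)$. It is densely defined and closable, and for all $b_1,\dots,b_m\in C(K)$ the element $\sum_i\varphi^i\otimes b_i$ lies in the domain of its adjoint $\pi^*$, with $$\Big(\pi^*\sum_i\varphi^i\otimes b_i\Big)(\Phi(y))=\sum_{i,j}Z^{ij}(y)\,b_i(y)\,[d_{\Phi(y)}x^j]\in T^*_{\Phi(y)}K_\Phi\qquad\text{for $\mu$-almost every }y\in K.$$ -/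

import Mathlib

open MeasureTheory Filter Topology Set
open scoped ZeroAtInfty UniformConvergence TensorProduct ENNReal

noncomputable section

/-! ### Dirichlet forms -/

section Dirichlet

variable {K : Type*} [MetricSpace K] [MeasurableSpace K] [BorelSpace K]

/-- A Dirichlet form on `L²(K, μ)`: a densely defined, closed, symmetric, non-negative definite
bilinear form on which the unit contraction `f ↦ (0 ∨ f) ∧ 1` operates. -/
structure DirichletForm (μ : Measure K) where
  /-- The domain `𝓕`. -/
  domain : Submodule ℝ (Lp ℝ 2 μ)
  /-- The form `𝓔`. -/
  form : domain →ₗ[ℝ] domain →ₗ[ℝ] ℝ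
  dense_domain : Dense (domain : Set (Lp ℝ 2 μ))
  symm : ∀ u v, form u v = form v u
  nonneg : ∀ u, 0 ≤ form u u
  /-- The domain is complete for `𝓔₁(u, v) = 𝓔(u, v) + ⟨u, v⟩`: every `𝓔₁`-Cauchy sequence
  converges. -/
  closed : ∀ u : ℕ → domain,
    (∀ ε > 0, ∃ N, ∀ k ≥ N, ∀ l ≥ N,
      form (u k - u l) (u k - u l) + ‖((u k - u l : domain) : Lp ℝ 2 μ)‖ ^ 2 < ε) →
    ∃ v : domain, Tendsto (fun k => form (u k - v) (u k - v)
      + ‖((u k - v : domain) : Lp ℝ 2 μ)‖ ^ 2) atTop (𝓝 0)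
  markov : ∀ f : domain, ∃ g : domain,
    ((g : Lp ℝ 2 μ) : K → ℝ) =ᵐ[μ] (fun x => min (max 0 ((f : Lp ℝ 2 μ) x)) 1) ∧
      form g g ≤ form f f

namespace DirichletForm

variable {μ : Measure K} (D : DirichletForm μ)

/-- The square of the norm of `𝓔₁(u, v) = 𝓔(u, v) + ⟨u, v⟩`. -/
def energyOne (u : D.domain) : ℝ := D.form u u + ‖(u : Lp ℝ 2 μ)‖ ^ 2

/-- Strong locality: `𝓔(u, v) = 0` if `v` is supported in a closed set `S` and `u` is constant on a
neighbourhood of `S`. -/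
def IsStronglyLocal : Prop :=
  ∀ (u v : D.domain) (S O : Set K) (c : ℝ), IsClosed S → IsOpen O → S ⊆ O →
    (∀ᵐ x ∂μ, x ∉ S → (v : Lp ℝ 2 μ) x = 0) → (∀ᵐ x ∂μ, x ∈ O → (u : Lp ℝ 2 μ) x = c) →
    D.form u v = 0

variable [IsFiniteMeasureOnCompacts μ]

/-- The Dirichlet algebra `𝓒 = C_c(K) ∩ 𝓕`: the continuous functions with compact support whose
class in `L²(K, μ)` belongs to `𝓕`. -/
def core : Submodule ℝ C(K, ℝ) where
  carrier := {f | ∃ h : HasCompactSupport f,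
    (f.continuous.memLp_of_hasCompactSupport (μ := μ) (p := 2) h).toLp f ∈ D.domain}
  zero_mem' := ⟨HasCompactSupport.zero, D.domain.zero_mem⟩
  add_mem' := fun ⟨hf, hf'⟩ ⟨hg, hg'⟩ => ⟨hf.add hg, D.domain.add_mem hf' hg'⟩
  smul_mem' := fun c _ ⟨hf, hf'⟩ => ⟨hf.smul_left (f := fun _ => c), D.domain.smul_mem c hf'⟩

/-- An element of `𝓒` as an element of `𝓕`. -/
def coreToDomain : D.core →ₗ[ℝ] D.domain where
  toFun f := ⟨(f.1.continuous.memLp_of_hasCompactSupport (μ := μ) (p := 2) f.2.1).toLp f.1,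
    f.2.2⟩
  map_add' _ _ := rfl
  map_smul' _ _ := rfl

/-- Regularity: `𝓒` is uniformly dense in `C_c(K)` and `𝓔₁`-dense in `𝓕`. -/
def IsRegular : Prop :=
  (∀ f : C(K, ℝ), HasCompactSupport f → ∀ ε > 0, ∃ g : D.core, ∀ x, |f x - g.1 x| < ε) ∧
  (∀ (u : D.domain), ∀ ε > 0, ∃ g : D.core, D.energyOne (u - D.coreToDomain g) < ε)

open Classical in
/-- `𝓔(f, g)` for `f, g ∈ 𝓒` (and `0` for other continuous functions). -/
def energy (f g : C(K, ℝ)) : ℝ :=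
  if h : f ∈ D.core ∧ g ∈ D.core then
    D.form (D.coreToDomain ⟨f, h.1⟩) (D.coreToDomain ⟨g, h.2⟩)
  else 0

/-- The number `∫ φ dΓ(f, g)` for `f, g, φ ∈ 𝓒`. This is the polarization of
`∫ φ dΓ(f) = 𝓔(φ f, f) - 𝓔(φ, f²) / 2`; the products lie in `𝓒`, because `𝓒` is an algebra. -/
def gammaIntegral (f g φ : C(K, ℝ)) : ℝ :=
  (D.energy (φ * f) g + D.energy (φ * g) f - D.energy φ (f * g)) / 2

/-- The finite signed measure `ν` is the mutual energy measure `Γ(f, g)`. -/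
def IsEnergyMeasure (f g : D.core) (ν : SignedMeasure K) : Prop :=
  ∀ φ : D.core, ν.integral φ.1 (ContinuousLinearMap.lsmul ℝ ℝ).flip =
    D.gammaIntegral f g φ

/-! ### The Hilbert space of Dirichlet 1-forms -/

/-- `B` is the bilinear form `⟨a ⊗ b, c ⊗ d⟩ = ∫ b d dΓ(a, c)` on `𝓒 ⊗ 𝓒`, and is a semi-inner
product. -/
def IsTensorForm (B : (D.core ⊗[ℝ] D.core) →ₗ[ℝ] (D.core ⊗[ℝ] D.core) →ₗ[ℝ] ℝ) : Prop :=
  (∀ x y, B x y = B y x) ∧ (∀ x, 0 ≤ B x x) ∧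
    ∀ a b c d : D.core, B (a ⊗ₜ b) (c ⊗ₜ d) =
      D.gammaIntegral a c (b.1 * d.1)

open Classical in
/-- The bilinear form `⟨a ⊗ b, c ⊗ d⟩ = ∫ b d dΓ(a, c)` on `𝓒 ⊗ 𝓒`. It is determined by its values
on simple tensors. Its existence and positivity are the standard facts that `𝓒` is an algebra and
that energy measures are positive; the value `0` in their absence is never used. -/
def tensorForm : (D.core ⊗[ℝ] D.core) →ₗ[ℝ] (D.core ⊗[ℝ] D.core) →ₗ[ℝ] ℝ :=
  if h : ∃ B, D.IsTensorForm B then h.choose else 0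

theorem tensorForm_symm (x y : D.core ⊗[ℝ] D.core) :
    D.tensorForm x y = D.tensorForm y x := by
  unfold tensorForm
  split_ifs with h
  · exact h.choose_spec.1 x y
  · rfl

theorem tensorForm_nonneg (x : D.core ⊗[ℝ] D.core) : 0 ≤ D.tensorForm x x := by
  unfold tensorForm
  split_ifs with h
  · exact h.choose_spec.2.1 x
  · exact le_refl (0 : ℝ)

/-- `𝓒 ⊗ 𝓒`, to be equipped with the semi-inner product `tensorForm`. -/
def PreForms : Type _ := D.core ⊗[ℝ] D.core

instance : AddCommGroup D.PreForms := inferInstanceAs (AddCommGroup (D.core ⊗[ℝ] D.core))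

instance : Module ℝ D.PreForms := inferInstanceAs (Module ℝ (D.core ⊗[ℝ] D.core))

/-- The semi-inner product on `𝓒 ⊗ 𝓒`. -/
@[reducible] def preFormsCore : PreInnerProductSpace.Core ℝ D.PreForms where
  inner x y := D.tensorForm x y
  conj_inner_symm x y := D.tensorForm_symm y x
  re_inner_nonneg x := D.tensorForm_nonneg x
  add_left x y z := by
    exact LinearMap.map_add₂ D.tensorForm x y z
  smul_left x y r := by
    exact LinearMap.map_smul₂ D.tensorForm r x y

instance : SeminormedAddCommGroup D.PreForms :=
  @InnerProductSpace.Core.toSeminormedAddCommGroup ℝ D.PreForms _ _ _ D.preFormsCore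

instance : InnerProductSpace ℝ D.PreForms := InnerProductSpace.ofCore D.preFormsCore

/-- The Hilbert space `𝓗` of Dirichlet 1-forms: the Hausdorff completion of `𝓒 ⊗ 𝓒`, in which
the null space of the semi-inner product is factored out. -/
abbrev Forms : Type _ := UniformSpace.Completion D.PreForms

/-- The class in `𝓗` of the simple tensor `a ⊗ b`, for `a, b ∈ 𝓒`. -/
def simpleTensor (a b : D.core) : D.Forms :=
  ((show D.PreForms from (a ⊗ₜ[ℝ] b : D.core ⊗[ℝ] D.core) : D.PreForms) : D.Forms)

/-- The filter on `𝓒` of uniform convergence on `K` to the function `b`. -/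
def uniformApprox (b : K → ℝ) : Filter D.core :=
  comap (fun b' : D.core => UniformFun.ofFun (fun x => b'.1 x))
    (𝓝 (UniformFun.ofFun b))

/-- The element `a ⊗ b` of `𝓗` for `a ∈ 𝓒` and a continuous function `b` which is a uniform limit
of functions in `𝓒`: the limit of `a ⊗ b'` in `𝓗`, as `b' ∈ 𝓒` tends to `b` uniformly. -/
def tensor (a : D.core) (b : K → ℝ) : D.Forms :=
  limUnder (D.uniformApprox b) (D.simpleTensor a)

end DirichletForm

end Dirichlet

/-! ### Differential forms of class `C` on subsets of Euclidean space -/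

section CForms

variable {m : ℕ}

/-- `f` belongs to `C¹₀(U) = C¹(U) ∩ C₀(closure U)`, with bounded first derivatives (so that its
`C¹` norm is finite). Only the values of `f` on the closure of `U` are relevant. -/
structure IsC10 (U : Set (EuclideanSpace ℝ (Fin m))) (f : EuclideanSpace ℝ (Fin m) → ℝ) :
    Prop where
  contDiffOn : ContDiffOn ℝ 1 f U
  continuousOn : ContinuousOn f (closure U)
  zero_at_infty : Tendsto f (cocompact _ ⊓ 𝓟 (closure U)) (𝓝 0)
  bounded_deriv : ∃ C : ℝ, ∀ p ∈ U, ‖fderiv ℝ f p‖ ≤ C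

/-- The subspace `d_p(𝓘_S)` of `T*_p U = ℝᵐ`, where `𝓘_S` is the ideal of functions in `C¹₀(U)`
that vanish on `S`, and `d_p f = ∑ (∂f/∂xⁱ)(p) d_p xⁱ` is identified with the gradient. -/
def dIdeal (U S : Set (EuclideanSpace ℝ (Fin m))) (p : EuclideanSpace ℝ (Fin m)) :
    Submodule ℝ (EuclideanSpace ℝ (Fin m)) :=
  Submodule.span ℝ {v | ∃ f, IsC10 U f ∧ (∀ q ∈ S, f q = 0) ∧ gradient f p = v}

/-- The cotangent space `T*_p S = T*_p U / d_p(𝓘_S)`. -/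
abbrev CotangentSpace (U S : Set (EuclideanSpace ℝ (Fin m))) (p : EuclideanSpace ℝ (Fin m)) :
    Type := EuclideanSpace ℝ (Fin m) ⧸ dIdeal U S p

/-- `Ω¹_C(U)`: the forms `ω = ∑ ωᵢ dxⁱ` with `ωᵢ ∈ C₀(closure U)`, with the norm
`sup_p (∑ ωᵢ(p)²)^(1/2)`. The coefficient `ωᵢ(p)` is `ω p i`. -/
abbrev CForms (U : Set (EuclideanSpace ℝ (Fin m))) : Type :=
  C₀(closure U, EuclideanSpace ℝ (Fin m))

/-- The restriction map `ρ`, which sends `ω ∈ Ω¹_C(U)` to the section `p ↦ [ω p]` of `T*S`. -/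
def restrictForm {U S : Set (EuclideanSpace ℝ (Fin m))} (hS : S ⊆ U) :
    CForms U →ₗ[ℝ] ((p : S) → CotangentSpace U S p) where
  toFun ω p := Submodule.Quotient.mk (ω ⟨p, subset_closure (hS p.2)⟩)
  map_add' _ _ := rfl
  map_smul' _ _ := rfl

/-- `Ω¹_C(S)`: the sections of `T*S` of the form `p ↦ [ω p]` with `ω ∈ Ω¹_C(U)`. -/
abbrev CFormsOn {U S : Set (EuclideanSpace ℝ (Fin m))} (hS : S ⊆ U) :
    Submodule ℝ ((p : S) → CotangentSpace U S p) :=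
  LinearMap.range (restrictForm hS)

/-- `Ω¹_{L²}(S, ν)`, the direct integral of the Hilbert spaces `T*_p S` over a measure `ν` carried
by `S`. A class in `T*_p S = ℝᵐ / d_p(𝓘_S)`, with the quotient norm, is given by its unique
representative in the orthogonal complement of `d_p(𝓘_S)`. -/
def L2Forms (U S : Set (EuclideanSpace ℝ (Fin m)))
    (ν : Measure (EuclideanSpace ℝ (Fin m))) :
    Submodule ℝ (Lp (EuclideanSpace ℝ (Fin m)) 2 ν) where
  carrier := {v | ∀ᵐ p ∂ν, v p ∈ (dIdeal U S p)ᗮ}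
  zero_mem' := by
    filter_upwards [Lp.coeFn_zero (EuclideanSpace ℝ (Fin m)) 2 ν] with p hp
    rw [hp]
    exact Submodule.zero_mem _
  add_mem' {v w} hv hw := by
    change ∀ᵐ p ∂ν, (v + w) p ∈ (dIdeal U S p)ᗮ
    filter_upwards [Lp.coeFn_add v w, hv, hw] with p hp h1 h2
    rw [hp]
    exact Submodule.add_mem _ h1 h2
  smul_mem' c v hv := by
    change ∀ᵐ p ∂ν, (c • v) p ∈ (dIdeal U S p)ᗮ
    filter_upwards [Lp.coeFn_smul c v, hv] with p hp h1
    rw [hp]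
    exact Submodule.smul_mem _ c h1

theorem isClosed_L2Forms (U S : Set (EuclideanSpace ℝ (Fin m)))
    (ν : Measure (EuclideanSpace ℝ (Fin m))) :
    IsClosed (L2Forms U S ν : Set (Lp (EuclideanSpace ℝ (Fin m)) 2 ν)) := by
  refine IsSeqClosed.isClosed fun v w hv hw => ?_
  obtain ⟨ns, -, hns⟩ := (tendstoInMeasure_of_tendsto_Lp hw).exists_seq_tendsto_ae
  have hv' : ∀ᵐ p ∂ν, ∀ n, v n p ∈ (dIdeal U S p)ᗮ := ae_all_iff.2 fun n => hv n
  change ∀ᵐ p ∂ν, w p ∈ (dIdeal U S p)ᗮ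
  filter_upwards [hns, hv'] with p h1 h2
  exact (Submodule.isClosed_orthogonal _).mem_of_tendsto h1 (Eventually.of_forall fun i => h2 _)

instance (U S : Set (EuclideanSpace ℝ (Fin m))) (ν : Measure (EuclideanSpace ℝ (Fin m))) :
    CompleteSpace (L2Forms U S ν) :=
  (isClosed_L2Forms U S ν).completeSpace_coe

end CForms

/-! ### Coordinate sequences -/

section Coordinates

variable {K : Type*} [MetricSpace K] [MeasurableSpace K] [BorelSpace K]

/-- A finite coordinate sequence `Φ = (φ¹, …, φᵐ)` for a Dirichlet form, together with the densities
`Zⁱʲ = dΓ(φⁱ, φʲ)/dμ`. Since `𝓒` consists of compactly supported functions and `C¹₀(ℝᵐ)` contains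
strictly positive functions, the condition `C¹(Φ) ⊆ 𝓒` entails that `K` is compact, and that
the functions `φⁱ` belong to `𝓒`. -/
structure CoordinateSequence {μ : Measure K} [IsFiniteMeasureOnCompacts μ]
    (D : DirichletForm μ) (m : ℕ) where
  /-- The coordinates `φⁱ`. -/
  coord : Fin m → D.core
  /-- The densities `Zⁱʲ`. -/
  Z : Fin m → Fin m → K → ℝ
  memLp_one : ∀ i j, MemLp (Z i j) 1 μ
  memLp_top : ∀ i j, MemLp (Z i j) ∞ μ
  isEnergyMeasure : ∀ i j, D.IsEnergyMeasure (coord i) (coord j) (μ.withDensityᵥ (Z i j))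
  /-- `C¹(Φ) = {F(φ¹, …, φᵐ) | F ∈ C¹₀(ℝᵐ)}` is contained in `𝓒`. -/
  comp_mem : ∀ F : EuclideanSpace ℝ (Fin m) → ℝ, IsC10 univ F →
    ∃ g : D.core, ∀ x, g.1 x = F (WithLp.toLp 2 fun i => (coord i).1 x)
  /-- `C¹(Φ)` is dense in `𝓒` with respect to `𝓔₁`. -/
  dense : ∀ f : D.core, ∀ ε > 0, ∃ F : EuclideanSpace ℝ (Fin m) → ℝ, IsC10 univ F ∧
    ∃ g : D.core,
      (∀ x, g.1 x = F (WithLp.toLp 2 fun i => (coord i).1 x)) ∧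
      D.energyOne (D.coreToDomain f - D.coreToDomain g) < ε

/-- The map `Φ : K → ℝᵐ`. -/
def CoordinateSequence.toMap {μ : Measure K} [IsFiniteMeasureOnCompacts μ]
    {D : DirichletForm μ} {m : ℕ} (Φ : CoordinateSequence D m) (x : K) :
    EuclideanSpace ℝ (Fin m) :=
  WithLp.toLp 2 fun i => (Φ.coord i).1 x

end Coordinates

end

/-! Everything rests on an approximation of `𝓔` by jump forms. The resolvent yields forms `𝓔_β(u, v)
= β⟨u - βG_β u, v⟩` with `𝓔_β → 𝓔` on the domain, and a bound on `𝓔_β(u, u)` along integers `β`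
forces `u` into the domain. A bump function of the coordinates shows that `1 ∈ 𝓒`, so `K` is
compact; strong locality makes `1` energy-free, hence `βG_β 1 = 1`. Since `βG_β` preserves
positivity, `⟨u, βG_β v⟩` extends to a positive functional on `C(K × K)`, and `𝓔_β(u, v) = J_β((u(x)
- u(y))(v(x) - v(y)))` with `J_β` positive (`IsConservative.approxForm_eq_jump`).

Consequently `𝓒` is an algebra, and the form on `𝓒 ⊗ 𝓒` is the limit of `J_n(k k')`, where `a ⊗ b`
has the kernel `k(x, y) = b(x)(a(x) - a(y))`. Positivity is then clear, and norm bounds in `𝓗`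
reduce to pointwise bounds on kernels (`IsConservative.norm_sq_toForms_le`); in particular `‖a ⊗ b‖
≤ √𝓔(a, a) ‖b‖_∞`, which defines `a ⊗ b` for continuous `b`.

Locality makes `J_n` vanish asymptotically near pairs `(x, y)` with `Φ(x) ≠ Φ(y)`. Near the
remaining pairs a `C¹` function of `Φ` is linear up to `o(|Φ(x) - Φ(y)|)`. This gives the chain rule
`(F ∘ Φ) ⊗ b = ∑ φⁱ ⊗ b (∂ᵢF ∘ Φ)` (`tensorRight_chain`), and the density of the range of `π`
follows from it.

For `f` vanishing on `K_Φ` the chain rule reads `∑ φⁱ ⊗ (∂ᵢf ∘ Φ) = 0`; pairing with `φⁱ ⊗ d` shows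
that the rows of `Z` are almost everywhere orthogonal to `d_p 𝓘`. Since `⟨∑ φⁱ ⊗ bᵢ, π ω⟩ = ∫ ⟨∑ Zⁱʲ
bᵢ dxʲ, ω⟩ dμ`, the value `π ω` depends only on the classes `[ω_p]`, and the same formula is the
adjoint identity. The adjoint is therefore defined on all `∑ φⁱ ⊗ bᵢ`, a dense set, so the operator
is closable. -/

set_option linter.unusedSectionVars false

/-! ### The resolvent of a Dirichlet form -/

namespace DirichletForm

variable {K : Type*} [MetricSpace K] [MeasurableSpace K] [BorelSpace K] {μ : Measure K}
  (D : DirichletForm μ)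

/-- The domain `𝓕`, to be equipped with the inner product `𝓔(u, v) + β ⟨u, v⟩`. -/
def EnergySpace (_β : Ioi (0 : ℝ)) : Type _ := D.domain

namespace EnergySpace

variable {D} {β : Ioi (0 : ℝ)}

instance : AddCommGroup (D.EnergySpace β) := inferInstanceAs (AddCommGroup D.domain)

instance : Module ℝ (D.EnergySpace β) := inferInstanceAs (Module ℝ D.domain)

/-- The identification of the energy space with the domain. -/
def toDomain : D.EnergySpace β ≃ₗ[ℝ] D.domain := LinearEquiv.refl ℝ D.domain

/-- The inner product `𝓔(u, v) + β ⟨u, v⟩`. -/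
@[reducible] noncomputable def core : InnerProductSpace.Core ℝ (D.EnergySpace β) where
  inner u v := D.form (toDomain u) (toDomain v) +
    β.1 * inner ℝ (toDomain u : Lp ℝ 2 μ) (toDomain v : Lp ℝ 2 μ)
  conj_inner_symm u v := by
    simp only [conj_trivial]
    rw [D.symm, real_inner_comm]
  re_inner_nonneg u := by
    have := D.nonneg (toDomain u)
    have h2 : 0 < β.1 := β.2
    have h3 := real_inner_self_nonneg (x := (toDomain u : Lp ℝ 2 μ))
    simp only [RCLike.re_to_real]
    positivity
  add_left u v w := by
    simp only [map_add, LinearMap.add_apply, Submodule.coe_add, inner_add_left]; ring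
  smul_left u v r := by
    simp only [map_smul, LinearMap.smul_apply, Submodule.coe_smul, real_inner_smul_left,
      smul_eq_mul, conj_trivial]; ring
  definite u h := by
    have := D.nonneg (toDomain u)
    have h2 : 0 < β.1 := β.2
    have h3 := real_inner_self_nonneg (x := (toDomain u : Lp ℝ 2 μ))
    have h4 : inner ℝ (toDomain u : Lp ℝ 2 μ) (toDomain u : Lp ℝ 2 μ) = 0 := by
      have : 0 ≤ β.1 * inner ℝ (toDomain u : Lp ℝ 2 μ) (toDomain u : Lp ℝ 2 μ) := by positivity
      have h5 : β.1 * inner ℝ (toDomain u : Lp ℝ 2 μ) (toDomain u : Lp ℝ 2 μ) = 0 := by linarith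
      exact (mul_eq_zero.1 h5).resolve_left h2.ne'
    have h6 : toDomain u = 0 := Subtype.ext (inner_self_eq_zero.1 h4)
    exact (LinearEquiv.map_eq_zero_iff _).1 h6

noncomputable instance : NormedAddCommGroup (D.EnergySpace β) :=
  @InnerProductSpace.Core.toNormedAddCommGroup ℝ (D.EnergySpace β) _ _ _ core

noncomputable instance : InnerProductSpace ℝ (D.EnergySpace β) :=
  InnerProductSpace.ofCore (core (D := D) (β := β)).toCore

theorem inner_eq (u v : D.EnergySpace β) : inner ℝ u v = D.form (toDomain u) (toDomain v) +
    β.1 * inner ℝ (toDomain u : Lp ℝ 2 μ) (toDomain v : Lp ℝ 2 μ) := rfl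

theorem norm_sq_eq (u : D.EnergySpace β) : ‖u‖ ^ 2 = D.form (toDomain u) (toDomain u) +
    β.1 * ‖(toDomain u : Lp ℝ 2 μ)‖ ^ 2 := by
  rw [← real_inner_self_eq_norm_sq, inner_eq, real_inner_self_eq_norm_sq]

instance : CompleteSpace (D.EnergySpace β) := by
  have hβ : 0 < β.1 := β.2
  refine Metric.complete_of_cauchySeq_tendsto fun u hu => ?_
  obtain ⟨v, hv⟩ := D.closed (fun k => toDomain (u k)) (by
    intro ε hε
    -- `𝓔₁ ≤ (1 + β⁻¹)(𝓔 + β‖·‖²)`; the reverse comparison below has the factor `1 + β`.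
    have h1 : 0 < 1 + β.1⁻¹ := by positivity
    obtain ⟨N, hN⟩ := Metric.cauchySeq_iff.1 hu (√(ε / (1 + β.1⁻¹))) (by positivity)
    refine ⟨N, fun k hk l hl => ?_⟩
    have h := hN k hk l hl
    rw [dist_eq_norm, Real.lt_sqrt (norm_nonneg _), norm_sq_eq, lt_div_iff₀ h1, map_sub] at h
    set w := toDomain (u k) - toDomain (u l)
    have h2 := D.nonneg w
    have h3 : (D.form w w + β.1 * ‖(w : Lp ℝ 2 μ)‖ ^ 2) * (1 + β.1⁻¹)
      = D.form w w + ‖(w : Lp ℝ 2 μ)‖ ^ 2 + (D.form w w * β.1⁻¹ +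
          β.1 * ‖(w : Lp ℝ 2 μ)‖ ^ 2) := by field_simp; ring
    have h4 : 0 ≤ D.form w w * β.1⁻¹ := by positivity
    have h5 : 0 ≤ β.1 * ‖(w : Lp ℝ 2 μ)‖ ^ 2 := by positivity
    linarith)
  refine ⟨toDomain.symm v, ?_⟩
  rw [tendsto_iff_norm_sub_tendsto_zero]
  have h0 : Tendsto (fun k => ‖u k - toDomain.symm v‖ ^ 2) atTop (𝓝 0) := by
    have := hv.const_mul (1 + β.1)
    rw [mul_zero] at this
    refine squeeze_zero (fun _ => by positivity) (fun k => ?_) this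
    rw [norm_sq_eq, map_sub, LinearEquiv.apply_symm_apply]
    set w := toDomain (u k) - v
    have h2 := D.nonneg w
    have h4 : 0 ≤ β.1 * D.form w w := by positivity
    nlinarith [sq_nonneg ‖(w : Lp ℝ 2 μ)‖]
  have := h0.sqrt
  simpa using this

/-- The embedding of the energy space in `L²`. -/
noncomputable def toLp : D.EnergySpace β →L[ℝ] Lp ℝ 2 μ :=
  LinearMap.mkContinuous (D.domain.subtype ∘ₗ (toDomain : D.EnergySpace β ≃ₗ[ℝ] D.domain)) (√β.1)⁻¹
    (fun u => by
      have hβ : 0 < β.1 := β.2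
      rw [inv_mul_eq_div, le_div_iff₀ (by positivity)]
      refine le_of_sq_le_sq ?_ (norm_nonneg _)
      rw [norm_sq_eq, mul_pow, Real.sq_sqrt hβ.le]
      have := D.nonneg (toDomain u)
      simp only [LinearMap.coe_comp, Submodule.coe_subtype, LinearEquiv.coe_coe,
        Function.comp_apply]
      linarith)

theorem toLp_apply (u : D.EnergySpace β) : toLp u = (toDomain u : Lp ℝ 2 μ) := rfl

end EnergySpace

/-- With `ι` the embedding of the energy space in `L²`, the adjoint satisfies `𝓔(ι*f, v) + β⟨ι*f, v⟩
= ⟨f, v⟩`, so `R = β ι*` works. -/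
theorem exists_resolvent {β : ℝ} (hβ : 0 < β) : ∃ R : Lp ℝ 2 μ →ₗ[ℝ] D.domain,
    ∀ f v, D.form (R f) v = β * inner ℝ (f - (R f : Lp ℝ 2 μ)) (v : Lp ℝ 2 μ) := by
  let b : Ioi (0 : ℝ) := ⟨β, hβ⟩
  let ι : D.EnergySpace b →L[ℝ] Lp ℝ 2 μ := EnergySpace.toLp
  refine ⟨β • EnergySpace.toDomain.toLinearMap ∘ₗ (ContinuousLinearMap.adjoint ι).toLinearMap,
    fun f v => ?_⟩
  have h := ContinuousLinearMap.adjoint_inner_left ι (EnergySpace.toDomain.symm v) f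
  rw [EnergySpace.inner_eq, EnergySpace.toLp_apply, LinearEquiv.apply_symm_apply] at h
  simp only [LinearMap.smul_apply, LinearMap.comp_apply, map_smul, Submodule.coe_smul,
    inner_sub_left, real_inner_smul_left, smul_eq_mul]
  rw [← h]
  change β * D.form (EnergySpace.toDomain (ContinuousLinearMap.adjoint ι f)) v = _
  simp only [LinearEquiv.coe_coe, ContinuousLinearMap.coe_coe]
  ring

open Classical in
/-- The operator `β G_β`, where `G_β` is the resolvent of the form. -/
noncomputable def resolvent (β : ℝ) : Lp ℝ 2 μ →ₗ[ℝ] D.domain :=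
  if hβ : 0 < β then (D.exists_resolvent hβ).choose else 0

variable {D} {β : ℝ}

theorem form_resolvent (hβ : 0 < β) (f : Lp ℝ 2 μ) (v : D.domain) :
    D.form (D.resolvent β f) v =
      β * inner ℝ (f - (D.resolvent β f : Lp ℝ 2 μ)) (v : Lp ℝ 2 μ) := by
  rw [resolvent, dif_pos hβ]
  exact (D.exists_resolvent hβ).choose_spec f v

theorem resolvent_symm (hβ : 0 < β) (f g : Lp ℝ 2 μ) :
    inner ℝ (D.resolvent β f : Lp ℝ 2 μ) g = inner ℝ f (D.resolvent β g : Lp ℝ 2 μ) := by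
  have h1 := form_resolvent hβ f (D.resolvent β g)
  have h2 := form_resolvent hβ g (D.resolvent β f)
  rw [D.symm, h1] at h2
  have h3 := mul_left_cancel₀ hβ.ne' h2
  rw [inner_sub_left, inner_sub_left, real_inner_comm (D.resolvent β f : Lp ℝ 2 μ)
    (D.resolvent β g : Lp ℝ 2 μ), real_inner_comm (D.resolvent β f : Lp ℝ 2 μ) g] at h3
  linarith

theorem form_sub_self (u v : D.domain) :
    D.form (u - v) (u - v) = D.form u u - 2 * D.form u v + D.form v v := by
  simp only [map_sub, LinearMap.sub_apply]
  rw [D.symm v u]; ring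

/-- `β G_β f` minimizes `𝓔(v, v) + β ‖v - f‖²`. -/
theorem form_add_norm_sq_eq (hβ : 0 < β) (f : Lp ℝ 2 μ) (v : D.domain) :
    D.form v v + β * ‖(v : Lp ℝ 2 μ) - f‖ ^ 2 =
      D.form (D.resolvent β f) (D.resolvent β f) +
        β * ‖(D.resolvent β f : Lp ℝ 2 μ) - f‖ ^ 2 +
      (D.form (v - D.resolvent β f) (v - D.resolvent β f) +
        β * ‖(v : Lp ℝ 2 μ) - D.resolvent β f‖ ^ 2) := by
  have h1 := form_resolvent hβ f (D.resolvent β f)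
  have h2 := form_resolvent hβ f v
  rw [form_sub_self, D.symm v (D.resolvent β f), h1, h2]
  simp only [← real_inner_self_eq_norm_sq, inner_sub_left, inner_sub_right]
  rw [real_inner_comm f (D.resolvent β f : Lp ℝ 2 μ), real_inner_comm f (v : Lp ℝ 2 μ),
    real_inner_comm (v : Lp ℝ 2 μ) (D.resolvent β f : Lp ℝ 2 μ)]
  ring

/-- Uniqueness of the minimizer: the defect term in `form_add_norm_sq_eq` must vanish. -/
theorem resolvent_eq_of_le (hβ : 0 < β) (f : Lp ℝ 2 μ) (v : D.domain)
    (h1 : D.form v v ≤ D.form (D.resolvent β f) (D.resolvent β f))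
    (h2 : ‖(v : Lp ℝ 2 μ) - f‖ ≤ ‖(D.resolvent β f : Lp ℝ 2 μ) - f‖) :
    v = D.resolvent β f := by
  have h := form_add_norm_sq_eq hβ f v
  have h3 : β * ‖(v : Lp ℝ 2 μ) - f‖ ^ 2 ≤ β * ‖(D.resolvent β f : Lp ℝ 2 μ) - f‖ ^ 2 := by gcongr
  have h4 := D.nonneg (v - D.resolvent β f)
  have h5 : β * ‖(v : Lp ℝ 2 μ) - D.resolvent β f‖ ^ 2 ≤ 0 := by linarith
  have h6 : ‖(v : Lp ℝ 2 μ) - D.resolvent β f‖ ^ 2 = 0 := by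
    have : 0 ≤ ‖(v : Lp ℝ 2 μ) - D.resolvent β f‖ ^ 2 := by positivity
    nlinarith
  exact Subtype.ext (sub_eq_zero.1 (norm_eq_zero.1 (pow_eq_zero_iff two_ne_zero |>.1 h6)))

theorem resolvent_eq_self (hβ : 0 < β) (u : D.domain) (h : ∀ v, D.form u v = 0) :
    D.resolvent β (u : Lp ℝ 2 μ) = u := by
  refine (resolvent_eq_of_le hβ _ _ ?_ ?_).symm
  · rw [h]; exact D.nonneg _
  · simp

/-- The Markov property of the resolvent. -/
theorem resolvent_mem_Icc (hβ : 0 < β) (f : Lp ℝ 2 μ) (hf : ∀ᵐ x ∂μ, f x ∈ Icc (0 : ℝ) 1) :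
    ∀ᵐ x ∂μ, (D.resolvent β f : Lp ℝ 2 μ) x ∈ Icc (0 : ℝ) 1 := by
  obtain ⟨g, hg, hle⟩ := D.markov (D.resolvent β f)
  -- Truncation to `[0, 1]` lowers the energy and, as `f` has values in `[0, 1]`, also the distance
  -- to `f`; hence the truncated minimizer is again the minimizer.
  have key : g = D.resolvent β f := by
    refine resolvent_eq_of_le hβ f g hle ?_
    refine Lp.norm_le_norm_of_ae_le ?_
    filter_upwards [hg, hf, Lp.coeFn_sub (g : Lp ℝ 2 μ) f,
      Lp.coeFn_sub (D.resolvent β f : Lp ℝ 2 μ) f] with x h1 h2 h3 h4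
    rw [h3, h4, Pi.sub_apply, Pi.sub_apply, h1, Real.norm_eq_abs, Real.norm_eq_abs]
    obtain ⟨h5, h6⟩ := h2
    generalize (D.resolvent β f : Lp ℝ 2 μ) x = r
    generalize f x = s at *
    rcases le_total r 0 with h | h <;> rcases le_total r 1 with h' | h' <;>
      simp [h, h', abs_le] <;>
      (try constructor) <;> (try cases abs_cases (r - s)) <;> linarith
  rw [← key]
  filter_upwards [hg] with x hx
  rw [hx]
  exact ⟨le_min (le_max_left _ _) zero_le_one, min_le_right _ _⟩

/-- The resolvent preserves positivity. -/
theorem resolvent_nonneg (hβ : 0 < β) (f : Lp ℝ 2 μ) {M : ℝ}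
    (hf : ∀ᵐ x ∂μ, f x ∈ Icc (0 : ℝ) M) :
    ∀ᵐ x ∂μ, 0 ≤ (D.resolvent β f : Lp ℝ 2 μ) x := by
  -- The maximum with `1` makes the scaling factor positive whatever the sign of `M`.
  have hM : 0 < max M 1 := by positivity
  have h := resolvent_mem_Icc (D := D) hβ ((max M 1)⁻¹ • f) (by
    filter_upwards [hf, Lp.coeFn_smul (max M 1)⁻¹ f] with x h1 h2
    rw [h2, Pi.smul_apply, smul_eq_mul]
    refine ⟨mul_nonneg (by positivity) h1.1, ?_⟩
    rw [inv_mul_le_one₀ hM]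
    exact h1.2.trans (le_max_left _ _))
  rw [map_smul, Submodule.coe_smul] at h
  filter_upwards [h, Lp.coeFn_smul (max M 1)⁻¹ (D.resolvent β f : Lp ℝ 2 μ)] with x h1 h2
  rw [h2, Pi.smul_apply, smul_eq_mul] at h1
  exact nonneg_of_mul_nonneg_right h1.1 (by positivity)

/-! ### The approximating forms -/

variable (D)

/-- The approximating form `𝓔_β(u, v) = β ⟨u - β G_β u, v⟩`. -/
noncomputable def approxForm (β : ℝ) (u v : Lp ℝ 2 μ) : ℝ :=
  β * inner ℝ (u - (D.resolvent β u : Lp ℝ 2 μ)) v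

variable {D}

theorem approxForm_eq_form (hβ : 0 < β) (u : Lp ℝ 2 μ) (v : D.domain) :
    D.approxForm β u v = D.form (D.resolvent β u) v := (form_resolvent hβ u v).symm

theorem form_sq_le (u v : D.domain) : D.form u v ^ 2 ≤ D.form u u * D.form v v := by
  have h : ∀ t : ℝ, 0 ≤ D.form v v * (t * t) + (2 * D.form u v) * t + D.form u u := fun t => by
    have := D.nonneg (u + t • v)
    simp only [map_add, map_smul, LinearMap.add_apply, LinearMap.smul_apply, smul_eq_mul] at this
    rw [D.symm v u] at this
    linarith
  have := discrim_le_zero h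
  rw [discrim] at this
  nlinarith

theorem form_resolvent_le (hβ : 0 < β) (u : D.domain) :
    D.form (D.resolvent β (u : Lp ℝ 2 μ)) (D.resolvent β (u : Lp ℝ 2 μ)) ≤ D.form u u := by
  have h := form_add_norm_sq_eq (D := D) hβ (u : Lp ℝ 2 μ) u
  have h1 := D.nonneg (u - D.resolvent β (u : Lp ℝ 2 μ))
  have h2 : 0 ≤ β * ‖(u : Lp ℝ 2 μ) - D.resolvent β (u : Lp ℝ 2 μ)‖ ^ 2 := by positivity
  have h3 : 0 ≤ β * ‖(D.resolvent β (u : Lp ℝ 2 μ) : Lp ℝ 2 μ) - u‖ ^ 2 := by positivity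
  simp only [sub_self, norm_zero] at h
  linarith

theorem approxForm_self_le (hβ : 0 < β) (u : D.domain) :
    D.approxForm β (u : Lp ℝ 2 μ) u ≤ D.form u u := by
  rw [approxForm_eq_form hβ]
  refine (le_abs_self _).trans (abs_le_of_sq_le_sq ?_ (D.nonneg _))
  have h1 := form_sq_le (D.resolvent β (u : Lp ℝ 2 μ)) u
  have h2 := form_resolvent_le hβ u
  have h3 := D.nonneg u
  nlinarith

/-- Both terms on the left are nonnegative, so a bound on `𝓔_β(u, u)` bounds the energy of `βG_β u`
and brings it within `O(β^(-1/2))` of `u`. -/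
theorem form_resolvent_le_approxForm (hβ : 0 < β) (u : Lp ℝ 2 μ) :
    D.form (D.resolvent β u) (D.resolvent β u) + β * ‖u - D.resolvent β u‖ ^ 2 =
      D.approxForm β u u := by
  rw [form_resolvent hβ, approxForm, ← real_inner_self_eq_norm_sq]
  simp only [inner_sub_left, inner_sub_right]
  ring

/-- With `d` the difference of the resolvents and `r = u - βG_β u`, one has `𝓔(d, d) = (γ - β)⟨r, d⟩
- γ‖d‖²`. Nonnegativity forces `⟨r, d⟩ ≥ 0`, that is `𝓔(βG_β u, d) ≥ 0`, and the square of the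
difference can be expanded. -/
theorem form_resolvent_sub_le {γ : ℝ} (hβ : 0 < β) (hγ : β ≤ γ) (u : Lp ℝ 2 μ) :
    D.form (D.resolvent γ u - D.resolvent β u) (D.resolvent γ u - D.resolvent β u) ≤
      D.form (D.resolvent γ u) (D.resolvent γ u) - D.form (D.resolvent β u) (D.resolvent β u) := by
  rcases hγ.eq_or_lt with rfl | hlt
  · simp
  have hγ0 : 0 < γ := hβ.trans hlt
  set d := D.resolvent γ u - D.resolvent β u with hd
  set r := u - (D.resolvent β u : Lp ℝ 2 μ) with hr
  have h1 := form_resolvent hγ0 u d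
  have h2 := form_resolvent hβ u d
  have hrd : u - (D.resolvent γ u : Lp ℝ 2 μ) = r - d := by
    rw [hr, hd, Submodule.coe_sub]; abel
  rw [hrd, inner_sub_left, real_inner_self_eq_norm_sq] at h1
  rw [← hr] at h2
  have h3 : D.form d d = D.form (D.resolvent γ u) d - D.form (D.resolvent β u) d := by
    rw [← LinearMap.sub_apply, ← map_sub, ← hd]
  have h4 := D.nonneg d
  have h5 : 0 ≤ inner ℝ r (d : Lp ℝ 2 μ) := by
    have : 0 ≤ (γ - β) * inner ℝ r (d : Lp ℝ 2 μ) := by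
      have : 0 ≤ γ * ‖(d : Lp ℝ 2 μ)‖ ^ 2 := by positivity
      rw [h3, h1, h2] at h4
      linarith
    exact nonneg_of_mul_nonneg_right this (by linarith)
  have h6 : D.form (D.resolvent β u) d =
      D.form (D.resolvent β u) (D.resolvent γ u) -
        D.form (D.resolvent β u) (D.resolvent β u) := by rw [hd, map_sub]
  have h7 := form_sub_self (D.resolvent γ u) (D.resolvent β u)
  rw [D.symm (D.resolvent γ u) (D.resolvent β u)] at h7
  rw [← hd] at h7
  have : 0 ≤ β * inner ℝ r (d : Lp ℝ 2 μ) := by positivity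
  linarith

/-- An element of `L²` along which the approximating forms are bounded belongs to the domain and is
the limit of its resolvents. -/
theorem exists_tendsto_resolvent (u : Lp ℝ 2 μ) {C : ℝ}
    (hC : ∀ n : ℕ, D.approxForm (n + 1) u u ≤ C) :
    ∃ v : D.domain, (v : Lp ℝ 2 μ) = u ∧
      Tendsto (fun n : ℕ => D.form (D.resolvent (n + 1) u - v) (D.resolvent (n + 1) u - v))
        atTop (𝓝 0) := by
  have hpos : ∀ n : ℕ, (0 : ℝ) < n + 1 := fun n => by positivity
  set w : ℕ → D.domain := fun n => D.resolvent (n + 1) u with hw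
  have hmono : ∀ k l, k ≤ l → D.form (w l - w k) (w l - w k) ≤
      D.form (w l) (w l) - D.form (w k) (w k) := fun k l hkl =>
    form_resolvent_sub_le (hpos k) (by exact_mod_cast Nat.succ_le_succ hkl) u
  have hle : ∀ n, D.form (w n) (w n) + (n + 1) * ‖u - w n‖ ^ 2 ≤ C := fun n =>
    (form_resolvent_le_approxForm (hpos n) u).trans_le (hC n)
  have hE : Monotone fun n => D.form (w n) (w n) := fun k l hkl => by
    have := D.nonneg (w l - w k)
    have := hmono k l hkl
    simp only
    linarith
  have hEb : BddAbove (range fun n => D.form (w n) (w n)) := ⟨C, by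
    rintro _ ⟨n, rfl⟩
    have := hle n
    have h2 : 0 ≤ ((n : ℝ) + 1) * ‖u - w n‖ ^ 2 := by positivity
    simp only
    linarith⟩
  -- The energies increase and are bounded, hence are Cauchy; `hmono` transfers this to the sequence
  -- `w` itself.
  have hEc := (tendsto_atTop_ciSup hE hEb).cauchySeq
  have hL : Tendsto (fun n => (w n : Lp ℝ 2 μ)) atTop (𝓝 u) := by
    rw [tendsto_iff_norm_sub_tendsto_zero]
    have h0 : Tendsto (fun n : ℕ => C * (1 / ((n : ℝ) + 1))) atTop (𝓝 (C * 0)) :=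
      tendsto_one_div_add_atTop_nhds_zero_nat.const_mul C
    rw [mul_zero] at h0
    have h1 : Tendsto (fun n => ‖(w n : Lp ℝ 2 μ) - u‖ ^ 2) atTop (𝓝 0) := by
      refine squeeze_zero (fun _ => by positivity) (fun n => ?_) h0
      rw [norm_sub_rev, mul_one_div, le_div_iff₀ (hpos n)]
      have := hle n
      have h2 := D.nonneg (w n)
      linarith
    simpa using h1.sqrt
  have hLc := hL.cauchySeq
  obtain ⟨v, hv⟩ := D.closed w (by
    intro ε hε
    obtain ⟨N₁, hN₁⟩ := Metric.cauchySeq_iff.1 hEc (ε / 2) (by positivity)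
    obtain ⟨N₂, hN₂⟩ := Metric.cauchySeq_iff.1 hLc (√(ε / 2)) (by positivity)
    refine ⟨max N₁ N₂, fun k hk l hl => ?_⟩
    have h1 := hN₁ k (le_of_max_le_left hk) l (le_of_max_le_left hl)
    have h2 := hN₂ k (le_of_max_le_right hk) l (le_of_max_le_right hl)
    rw [dist_eq_norm, Real.lt_sqrt (norm_nonneg _)] at h2
    rw [Real.dist_eq] at h1
    have h3 : D.form (w k - w l) (w k - w l) < ε / 2 := by
      rcases le_total k l with h | h
      · have := hmono k l h
        rw [abs_lt] at h1
        have h4 : D.form (w k - w l) (w k - w l) = D.form (w l - w k) (w l - w k) := by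
          rw [form_sub_self, form_sub_self, D.symm (w k) (w l)]; ring
        linarith
      · have := hmono l k h
        rw [abs_lt] at h1
        linarith
    rw [Submodule.coe_sub]
    linarith)
  have hvu : (v : Lp ℝ 2 μ) = u := by
    refine tendsto_nhds_unique ?_ hL
    rw [tendsto_iff_norm_sub_tendsto_zero]
    have h1 : Tendsto (fun n => ‖(w n : Lp ℝ 2 μ) - v‖ ^ 2) atTop (𝓝 0) := by
      refine squeeze_zero (fun _ => by positivity) (fun n => ?_) hv
      have := D.nonneg (w n - v)
      rw [Submodule.coe_sub]
      linarith
    simpa using h1.sqrt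
  refine ⟨v, hvu, squeeze_zero (fun _ => D.nonneg _) (fun n => ?_) hv⟩
  have : 0 ≤ ‖((w n - v : D.domain) : Lp ℝ 2 μ)‖ ^ 2 := by positivity
  linarith

theorem mem_domain_of_approxForm_le (u : Lp ℝ 2 μ) {C : ℝ}
    (hC : ∀ n : ℕ, D.approxForm (n + 1) u u ≤ C) : u ∈ D.domain := by
  obtain ⟨v, rfl, -⟩ := exists_tendsto_resolvent u hC
  exact v.2

/-- `𝓔_β(u, v) = 𝓔(βG_β u, v)`, and `βG_β u → u` in energy, so Cauchy–Schwarz applies. -/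
theorem tendsto_approxForm (u v : D.domain) :
    Tendsto (fun n : ℕ => D.approxForm (n + 1) (u : Lp ℝ 2 μ) v) atTop (𝓝 (D.form u v)) := by
  have hpos : ∀ n : ℕ, (0 : ℝ) < n + 1 := fun n => by positivity
  obtain ⟨u', hu', h⟩ := exists_tendsto_resolvent (D := D) (u : Lp ℝ 2 μ) (C := D.form u u)
    fun n => approxForm_self_le (hpos n) u
  obtain rfl : u' = u := Subtype.ext hu'
  rw [tendsto_iff_norm_sub_tendsto_zero]
  have h1 := (h.mul_const (D.form v v)).sqrt
  rw [zero_mul, Real.sqrt_zero] at h1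
  refine squeeze_zero (fun _ => norm_nonneg _) (fun n => ?_) h1
  rw [approxForm_eq_form (hpos n), ← LinearMap.sub_apply, ← map_sub]
  exact Real.abs_le_sqrt (form_sq_le _ _)

end DirichletForm

/-- A linear map that vanishes on the kernel of `f` factors through the range of `f`. -/
theorem LinearMap.exists_range_lift {R M N P : Type*} [Ring R] [AddCommGroup M] [AddCommGroup N]
    [AddCommGroup P] [Module R M] [Module R N] [Module R P] (f : M →ₗ[R] N) (g : M →ₗ[R] P)
    (h : LinearMap.ker f ≤ LinearMap.ker g) :
    ∃ g' : LinearMap.range f →ₗ[R] P, ∀ x, g' ⟨f x, LinearMap.mem_range_self f x⟩ = g x :=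
  ⟨(LinearMap.ker f).liftQ g h ∘ₗ f.quotKerEquivRange.symm.toLinearMap, fun x => by
    simp [LinearMap.quotKerEquivRange_symm_apply_image]⟩

/-! ### Functions of two variables -/

section TwoVariables

variable {K : Type*} [TopologicalSpace K]

/-- The function `(x, y) ↦ f x`. -/
noncomputable abbrev liftFst : C(K, ℝ) →ₐ[ℝ] C(K × K, ℝ) :=
  ContinuousMap.compRightAlgHom ℝ ℝ ⟨Prod.fst, continuous_fst⟩

/-- The function `(x, y) ↦ f y`. -/
noncomputable abbrev liftSnd : C(K, ℝ) →ₐ[ℝ] C(K × K, ℝ) :=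
  ContinuousMap.compRightAlgHom ℝ ℝ ⟨Prod.snd, continuous_snd⟩

/-- The function `(x, y) ↦ f x - f y`. -/
noncomputable def increment : C(K, ℝ) →ₗ[ℝ] C(K × K, ℝ) :=
  liftFst.toLinearMap - liftSnd.toLinearMap

theorem liftFst_apply (f : C(K, ℝ)) (z : K × K) : liftFst f z = f z.1 := rfl

theorem increment_eq (f : C(K, ℝ)) : increment f = liftFst f - liftSnd f := rfl

theorem increment_apply (f : C(K, ℝ)) (z : K × K) : increment f z = f z.1 - f z.2 := rfl

end TwoVariables

/-! ### Positive functionals on `C(K × K)` obtained from the resolvent. -/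

namespace DirichletForm

variable {K : Type*} [MetricSpace K] [MeasurableSpace K] [BorelSpace K] [CompactSpace K]
  {μ : Measure K} [IsFiniteMeasureOnCompacts μ] (D : DirichletForm μ) {β : ℝ}

/-- The class in `L²` of a continuous function. -/
noncomputable abbrev toL2 (μ : Measure K) [IsFiniteMeasureOnCompacts μ] :
    C(K, ℝ) →L[ℝ] Lp ℝ 2 μ :=
  ContinuousMap.toLp 2 μ ℝ

theorem inner_toL2 (f g : C(K, ℝ)) : inner ℝ (toL2 μ f) (toL2 μ g) = ∫ x, f x * g x ∂μ := by
  rw [ContinuousMap.inner_toLp]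
  simp [mul_comm]

theorem inner_toL2_left (f : C(K, ℝ)) (g : Lp ℝ 2 μ) :
    inner ℝ (toL2 μ f) g = ∫ x, f x * g x ∂μ := by
  rw [L2.inner_def]
  refine integral_congr_ae ?_
  filter_upwards [ContinuousMap.coeFn_toLp (p := 2) (𝕜 := ℝ) μ f] with x hx
  rw [hx]
  simp [mul_comm]

theorem integrable_mul_Lp (f : C(K, ℝ)) (g : Lp ℝ 2 μ) : Integrable (fun x => f x * g x) μ := by
  have h : Integrable (fun x => inner ℝ ((toL2 μ f) x) (g x)) μ := L2.integrable_inner _ _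
  refine h.congr ?_
  filter_upwards [ContinuousMap.coeFn_toLp (p := 2) (𝕜 := ℝ) μ f] with x hx
  rw [hx]
  simp [mul_comm]

variable {D}

/-- The resolvent is given by a positive kernel. -/
theorem sum_inner_resolvent_nonneg (hβ : 0 < β) {ι : Type*} (s : Finset ι) (u v : ι → C(K, ℝ))
    (h : ∀ x y, 0 ≤ ∑ i ∈ s, u i x * v i y) :
    0 ≤ ∑ i ∈ s, inner ℝ (toL2 μ (u i)) (D.resolvent β (toL2 μ (v i)) : Lp ℝ 2 μ) := by
  obtain ⟨S, hSc, hSd⟩ := TopologicalSpace.exists_countable_dense K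
  set r : ι → Lp ℝ 2 μ := fun i => (D.resolvent β (toL2 μ (v i)) : Lp ℝ 2 μ) with hr
  -- Freezing the first variable at `x₀` leaves a nonnegative function of `y`, to which positivity
  -- of the resolvent applies. The null set depends on `x₀`; a countable dense set of `x₀` and
  -- continuity in `x₀` then permit `x₀ = x`.
  have h1 : ∀ x₀, ∀ᵐ x ∂μ, 0 ≤ ∑ i ∈ s, u i x₀ * r i x := fun x₀ => by
    set f : C(K, ℝ) := ∑ i ∈ s, u i x₀ • v i with hf
    have hfx : ∀ y, f y = ∑ i ∈ s, u i x₀ * v i y := fun y => by simp [hf]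
    have h2 := resolvent_nonneg (D := D) hβ (toL2 μ f) (M := ‖f‖) (by
      filter_upwards [ContinuousMap.coeFn_toLp (p := 2) (𝕜 := ℝ) μ f] with x hx
      rw [hx]
      refine ⟨?_, (le_abs_self _).trans (f.norm_coe_le_norm x)⟩
      rw [hfx]
      exact h x₀ x)
    have h3 : (D.resolvent β (toL2 μ f) : Lp ℝ 2 μ) = ∑ i ∈ s, u i x₀ • r i := by
      simp only [hf, map_sum, map_smul, AddSubmonoidClass.coe_finsetSum, Submodule.coe_smul, hr]
    rw [h3] at h2
    have h4 : ∀ᵐ x ∂μ, ∀ i ∈ s, (u i x₀ • r i : Lp ℝ 2 μ) x = u i x₀ * r i x := by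
      rw [Filter.eventually_all_finset]
      intro i _
      filter_upwards [Lp.coeFn_smul (u i x₀) (r i)] with x hx
      rw [hx]; rfl
    filter_upwards [h2, h4, Lp.coeFn_finsetSum s (fun i => u i x₀ • r i)] with x h5 h6 h7
    rw [h7, Finset.sum_apply, Finset.sum_congr rfl h6] at h5
    exact h5
  have h2 : ∀ᵐ x ∂μ, 0 ≤ ∑ i ∈ s, u i x * r i x := by
    have h3 : ∀ᵐ x ∂μ, ∀ x₀ ∈ S, 0 ≤ ∑ i ∈ s, u i x₀ * r i x :=
      (ae_ball_iff hSc).2 fun x₀ _ => h1 x₀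
    filter_upwards [h3] with x hx
    have hcl : IsClosed {x₀ | 0 ≤ ∑ i ∈ s, u i x₀ * r i x} :=
      isClosed_le continuous_const (by fun_prop)
    exact hcl.closure_subset_iff.2 hx (hSd x)
  calc (0 : ℝ) ≤ ∫ x, ∑ i ∈ s, u i x * r i x ∂μ := integral_nonneg_of_ae h2
    _ = _ := by
      rw [integral_finsetSum _ fun i _ => integrable_mul_Lp _ _]
      exact Finset.sum_congr rfl fun i _ => (inner_toL2_left _ _).symm

/-- The pairing is positive on finite sums `∑ uᵢ(x) vᵢ(y)`; positivity applied to `t` and `-t` also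
shows that it depends only on the function. This subspace contains the constants, which dominate
every continuous function on the compact square, so the M. Riesz extension theorem applies and no
kernel measure is needed. -/
theorem exists_resolventKernel (hβ : 0 < β) : ∃ Λ : C(K × K, ℝ) →ₗ[ℝ] ℝ,
    (∀ h, 0 ≤ h → 0 ≤ Λ h) ∧ ∀ u v : C(K, ℝ), Λ (liftFst u * liftSnd v) =
      inner ℝ (toL2 μ u) (D.resolvent β (toL2 μ v) : Lp ℝ 2 μ) := by
  let τ : C(K, ℝ) ⊗[ℝ] C(K, ℝ) →ₗ[ℝ] C(K × K, ℝ) :=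
    (Algebra.TensorProduct.productMap liftFst liftSnd).toLinearMap
  let j : C(K, ℝ) ⊗[ℝ] C(K, ℝ) →ₗ[ℝ] ℝ := TensorProduct.lift
    ((innerₗ (Lp ℝ 2 μ)).compl₁₂ (toL2 μ).toLinearMap
      (D.domain.subtype ∘ₗ D.resolvent β ∘ₗ (toL2 μ).toLinearMap))
  have hτ : ∀ u v, τ (u ⊗ₜ v) = liftFst u * liftSnd v := fun u v =>
    Algebra.TensorProduct.productMap_apply_tmul _ _ u v
  have hj : ∀ u v, j (u ⊗ₜ v) =
      inner ℝ (toL2 μ u) (D.resolvent β (toL2 μ v) : Lp ℝ 2 μ) := fun u v => by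
    simp [j]
  have hpos : ∀ t, 0 ≤ τ t → 0 ≤ j t := fun t ht => by
    obtain ⟨S, rfl⟩ := TensorProduct.exists_finset t
    simp only [map_sum, hτ, hj] at ht ⊢
    refine sum_inner_resolvent_nonneg hβ S _ _ fun x y => ?_
    simpa using ContinuousMap.le_def.1 ht (x, y)
  obtain ⟨j', hj'⟩ := LinearMap.exists_range_lift τ j (fun t ht => by
    rw [LinearMap.mem_ker] at ht ⊢
    refine le_antisymm ?_ (hpos t ht.ge)
    have := hpos (-t) (by rw [map_neg, ht, neg_zero])
    rw [map_neg] at this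
    linarith)
  obtain ⟨Λ, hΛ, hΛ'⟩ := riesz_extension (PointedCone.positive ℝ C(K × K, ℝ))
    ⟨LinearMap.range τ, j'⟩ (by
      rintro ⟨_, t, rfl⟩ ht
      change 0 ≤ j' _
      rw [hj']
      exact hpos t ((PointedCone.mem_positive ℝ _).1 ht)) (fun h => by
      refine ⟨⟨‖h‖ • τ (1 ⊗ₜ 1), Submodule.smul_mem _ _ (LinearMap.mem_range_self _ _)⟩, ?_⟩
      rw [PointedCone.mem_positive]
      change 0 ≤ ‖h‖ • τ (1 ⊗ₜ 1) + h
      rw [hτ]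
      intro z
      have := neg_abs_le (h z)
      have h2 : |h z| ≤ ‖h‖ := h.norm_coe_le_norm z
      simp
      linarith)
  refine ⟨Λ, fun h hh => hΛ' h ((PointedCone.mem_positive ℝ _).2 hh), fun u v => ?_⟩
  rw [← hτ, ← hj, ← hj']
  exact hΛ ⟨τ (u ⊗ₜ v), LinearMap.mem_range_self _ _⟩

variable (D) in
open Classical in
/-- The positive functional `h ↦ (β / 2) ∫∫ h(x, y) β G_β(dx, dy)`. -/
noncomputable def jump (β : ℝ) : C(K × K, ℝ) →ₗ[ℝ] ℝ :=
  if hβ : 0 < β then (β / 2) • (D.exists_resolventKernel hβ).choose else 0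

theorem jump_nonneg (h : C(K × K, ℝ)) (hh : 0 ≤ h) : 0 ≤ D.jump β h := by
  unfold jump
  split_ifs with hβ
  · exact mul_nonneg (by positivity) ((exists_resolventKernel hβ).choose_spec.1 h hh)
  · exact le_refl (0 : ℝ)

theorem jump_mono {h k : C(K × K, ℝ)} (hk : h ≤ k) : D.jump β h ≤ D.jump β k := by
  have := jump_nonneg (D := D) (β := β) (k - h) (sub_nonneg.2 hk)
  rw [map_sub] at this
  linarith

theorem jump_liftFst_mul_liftSnd (hβ : 0 < β) (u v : C(K, ℝ)) :
    D.jump β (liftFst u * liftSnd v) =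
      β / 2 * inner ℝ (toL2 μ u) (D.resolvent β (toL2 μ v) : Lp ℝ 2 μ) := by
  rw [jump, dif_pos hβ, LinearMap.smul_apply, (exists_resolventKernel hβ).choose_spec.2,
    smul_eq_mul]

theorem inner_toL2_mul (u v w : C(K, ℝ)) :
    inner ℝ (toL2 μ (u * w)) (toL2 μ v) = inner ℝ (toL2 μ u) (toL2 μ (w * v)) := by
  simp [inner_toL2, mul_assoc]

/-! ### The Dirichlet algebra -/

theorem coe_coreToDomain (f : D.core) : (D.coreToDomain f : Lp ℝ 2 μ) = toL2 μ f.1 := by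
  refine Lp.ext ?_
  exact (MemLp.coeFn_toLp (f.1.continuous.memLp_of_hasCompactSupport f.2.1)).trans
    (ContinuousMap.coeFn_toLp (p := 2) (𝕜 := ℝ) μ f.1).symm

theorem mem_core_iff (f : C(K, ℝ)) : f ∈ D.core ↔ toL2 μ f ∈ D.domain := by
  have h : HasCompactSupport f := HasCompactSupport.of_compactSpace _
  have h2 : (f.continuous.memLp_of_hasCompactSupport (μ := μ) (p := 2) h).toLp f = toL2 μ f :=
    Lp.ext ((MemLp.coeFn_toLp _).trans (ContinuousMap.coeFn_toLp (p := 2) (𝕜 := ℝ) μ f).symm)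
  exact ⟨fun h' => h2 ▸ h'.2, fun h' => ⟨h, h2 ▸ h'⟩⟩

theorem energy_eq (f g : D.core) :
    D.energy f g = D.form (D.coreToDomain f) (D.coreToDomain g) := by
  rw [energy, dif_pos ⟨f.2, g.2⟩]

variable (D) in
/-- The constants belong to the domain and have no energy. -/
def IsConservative : Prop :=
  ∃ h : (1 : C(K, ℝ)) ∈ D.core, ∀ v, D.form (D.coreToDomain ⟨1, h⟩) v = 0

theorem IsConservative.resolvent_one (hD : D.IsConservative) (hβ : 0 < β) :
    (D.resolvent β (toL2 μ 1) : Lp ℝ 2 μ) = toL2 μ 1 := by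
  obtain ⟨h, h'⟩ := hD
  have := resolvent_eq_self hβ _ h'
  rw [coe_coreToDomain] at this
  rw [this, coe_coreToDomain]

theorem IsConservative.jump_liftFst (hD : D.IsConservative) (hβ : 0 < β) (u : C(K, ℝ)) :
    D.jump β (liftFst u) = β / 2 * inner ℝ (toL2 μ u) (toL2 μ 1) := by
  have := jump_liftFst_mul_liftSnd (D := D) hβ u 1
  rwa [map_one, mul_one, hD.resolvent_one hβ] at this

theorem IsConservative.jump_liftSnd (hD : D.IsConservative) (hβ : 0 < β) (u : C(K, ℝ)) :
    D.jump β (liftSnd u) = β / 2 * inner ℝ (toL2 μ u) (toL2 μ 1) := by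
  have := jump_liftFst_mul_liftSnd (D := D) hβ 1 u
  rwa [map_one, one_mul, ← resolvent_symm hβ, hD.resolvent_one hβ, real_inner_comm] at this

theorem approxForm_toL2 (hβ : 0 < β) (u v : C(K, ℝ)) :
    D.approxForm β (toL2 μ u) (toL2 μ v) =
      β * inner ℝ (toL2 μ u) (toL2 μ v) - 2 * D.jump β (liftFst u * liftSnd v) := by
  rw [approxForm, inner_sub_left, resolvent_symm hβ, jump_liftFst_mul_liftSnd hβ]
  ring

/-- Conservativeness evaluates the two terms of the expanded product that depend on one variable
only: each gives `(β / 2)⟨u, v⟩`. This explains the factor `β / 2` in `jump`. -/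
theorem IsConservative.approxForm_eq_jump (hD : D.IsConservative) (hβ : 0 < β) (u v : C(K, ℝ)) :
    D.approxForm β (toL2 μ u) (toL2 μ v) = D.jump β (increment u * increment v) := by
  have h1 : increment u * increment v = liftFst (u * v) + liftSnd (u * v) -
      liftFst u * liftSnd v - liftFst v * liftSnd u := by
    simp only [increment_eq, map_mul]; ring
  have h2 := jump_liftFst_mul_liftSnd (D := D) hβ u v
  rw [h1, approxForm_toL2 hβ]
  simp only [map_sub, map_add]
  rw [hD.jump_liftFst hβ, hD.jump_liftSnd hβ, h2, jump_liftFst_mul_liftSnd hβ v u,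
    ← resolvent_symm (D := D) hβ (toL2 μ v) (toL2 μ u), real_inner_comm (toL2 μ u), inner_toL2_mul, mul_one]
  ring

/-- The right side is the formula for `∫ φ dΓ(a, c)` with `𝓔_β` in place of `𝓔`, so its limit is the
energy measure. -/
theorem IsConservative.jump_liftFst_mul (hD : D.IsConservative) (hβ : 0 < β) (φ a c : C(K, ℝ)) :
    D.jump β (liftFst φ * increment a * increment c) =
      (D.approxForm β (toL2 μ (φ * a)) (toL2 μ c) + D.approxForm β (toL2 μ (φ * c)) (toL2 μ a)
        - D.approxForm β (toL2 μ φ) (toL2 μ (a * c))) / 2 := by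
  have h1 : liftFst φ * increment a * increment c = liftFst (φ * a * c) -
      liftFst (φ * a) * liftSnd c - liftFst (φ * c) * liftSnd a + liftFst φ * liftSnd (a * c) := by
    simp only [increment_eq, map_mul]; ring
  rw [h1, approxForm_toL2 hβ, approxForm_toL2 hβ, approxForm_toL2 hβ]
  simp only [map_sub, map_add]
  rw [hD.jump_liftFst hβ, inner_toL2_mul (φ * a), mul_one, inner_toL2_mul φ a c, inner_toL2_mul φ c a, mul_comm c a]
  ring

theorem IsConservative.tendsto_jump (hD : D.IsConservative) (u v : D.core) :
    Tendsto (fun n : ℕ => D.jump (n + 1) (increment u.1 * increment v.1)) atTop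
      (𝓝 (D.form (D.coreToDomain u) (D.coreToDomain v))) := by
  refine (tendsto_approxForm (D.coreToDomain u) (D.coreToDomain v)).congr fun n => ?_
  rw [coe_coreToDomain, coe_coreToDomain, hD.approxForm_eq_jump (by positivity)]

/-- Continuous functions whose increments are dominated by those of an element of the core belong
to the core. -/
theorem IsConservative.mem_core_of_increment_le (hD : D.IsConservative) (f : D.core) (g : C(K, ℝ))
    {L : ℝ} (h : ∀ x y, |g x - g y| ≤ L * |f.1 x - f.1 y|) : g ∈ D.core := by
  rw [mem_core_iff]
  refine mem_domain_of_approxForm_le (C := L ^ 2 * D.form (D.coreToDomain f) (D.coreToDomain f)) _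
    fun n => ?_
  have hn : (0 : ℝ) < n + 1 := by positivity
  calc D.approxForm (n + 1) (toL2 μ g) (toL2 μ g)
      = D.jump (n + 1) (increment g * increment g) := hD.approxForm_eq_jump hn g g
    _ ≤ D.jump (n + 1) (L ^ 2 • (increment f.1 * increment f.1)) := by
      refine jump_mono fun z => ?_
      have h1 := pow_le_pow_left₀ (abs_nonneg _) (h z.1 z.2) 2
      rw [mul_pow, sq_abs, sq_abs] at h1
      change (increment g * increment g) z ≤ (L ^ 2 • (increment f.1 * increment f.1)) z
      simp only [ContinuousMap.mul_apply, increment_apply, ContinuousMap.smul_apply, smul_eq_mul]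
      linarith
    _ = L ^ 2 * D.approxForm (n + 1) (D.coreToDomain f : Lp ℝ 2 μ) (D.coreToDomain f) := by
      rw [map_smul, coe_coreToDomain, hD.approxForm_eq_jump hn, smul_eq_mul]
    _ ≤ _ := by
      gcongr
      exact approxForm_self_le hn _

/-- Squares suffice by polarization, and the increment of `f²` is `f(x) + f(y)` times that of `f`;
this is where the constant `2‖f‖` comes from. -/
theorem IsConservative.mul_mem_core (hD : D.IsConservative) {f g : C(K, ℝ)} (hf : f ∈ D.core)
    (hg : g ∈ D.core) : f * g ∈ D.core := by
  have hsq : ∀ f ∈ D.core, f * f ∈ D.core := fun f hf =>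
    hD.mem_core_of_increment_le ⟨f, hf⟩ (f * f) (L := 2 * ‖f‖) fun x y => by
      have h1 : |f x + f y| ≤ 2 * ‖f‖ := by
        have h1 : |f x| ≤ ‖f‖ := f.norm_coe_le_norm x
        have h2 : |f y| ≤ ‖f‖ := f.norm_coe_le_norm y
        linarith [abs_add_le (f x) (f y)]
      calc |(f * f) x - (f * f) y| = |f x + f y| * |f x - f y| := by
            rw [← abs_mul]; congr 1; simp only [ContinuousMap.mul_apply]; ring
        _ ≤ _ := by gcongr
  have h : f * g = (4⁻¹ : ℝ) • ((f + g) * (f + g) - (f - g) * (f - g)) := by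
    ext x; simp; ring
  rw [h]
  exact D.core.smul_mem _ (D.core.sub_mem (hsq _ (D.core.add_mem hf hg))
    (hsq _ (D.core.sub_mem hf hg)))

end DirichletForm

namespace DirichletForm

variable {K : Type*} [MetricSpace K] [MeasurableSpace K] [BorelSpace K] [CompactSpace K]
  {μ : Measure K} [IsFiniteMeasureOnCompacts μ] {D : DirichletForm μ}

/-! ### The semi-inner product on `𝓒 ⊗ 𝓒` -/

theorem IsConservative.tendsto_gammaIntegral (hD : D.IsConservative) (a c φ : D.core) :
    Tendsto (fun n : ℕ => D.jump (n + 1) (liftFst φ.1 * increment a.1 * increment c.1)) atTop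
      (𝓝 (D.gammaIntegral a c φ)) := by
  have h : ∀ u v : D.core, Tendsto (fun n : ℕ => D.approxForm (n + 1) (toL2 μ u.1) (toL2 μ v.1))
      atTop (𝓝 (D.energy u v)) := fun u v => by
    rw [energy_eq]
    refine (tendsto_approxForm (D.coreToDomain u) (D.coreToDomain v)).congr fun n => ?_
    rw [coe_coreToDomain, coe_coreToDomain]
  have h1 := ((h ⟨_, hD.mul_mem_core φ.2 a.2⟩ c).add (h ⟨_, hD.mul_mem_core φ.2 c.2⟩ a)).sub
    (h φ ⟨_, hD.mul_mem_core a.2 c.2⟩)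
  refine (h1.div_const 2).congr fun n => ?_
  rw [hD.jump_liftFst_mul (by positivity)]

variable (D) in
/-- The map `a ⊗ b ↦ b(x) (a(x) - a(y))`. -/
noncomputable def tensorKernel : D.core ⊗[ℝ] D.core →ₗ[ℝ] C(K × K, ℝ) :=
  TensorProduct.lift ((LinearMap.mul ℝ C(K × K, ℝ)).flip.compl₁₂ (increment ∘ₗ D.core.subtype)
    (liftFst.toLinearMap ∘ₗ D.core.subtype))

theorem tensorKernel_tmul (a b : D.core) :
    D.tensorKernel (a ⊗ₜ b) = liftFst b.1 * increment a.1 := rfl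

/-- Makes the semi-inner product accessible through kernels on `K × K`: pointwise inequalities
between kernels survive in the limit. -/
theorem IsConservative.tendsto_of_forall_tmul (hD : D.IsConservative)
    (B : (D.core ⊗[ℝ] D.core) →ₗ[ℝ] (D.core ⊗[ℝ] D.core) →ₗ[ℝ] ℝ)
    (hB : ∀ a b c d : D.core, B (a ⊗ₜ b) (c ⊗ₜ d) = D.gammaIntegral a c (b.1 * d.1))
    (x y : D.core ⊗[ℝ] D.core) :
    Tendsto (fun n : ℕ => D.jump (n + 1) (D.tensorKernel x * D.tensorKernel y)) atTop
      (𝓝 (B x y)) := by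
  induction x with
  | zero => simp
  | add x x' hx hx' => simpa only [map_add, add_mul, LinearMap.add_apply] using hx.add hx'
  | tmul a b =>
    induction y with
    | zero => simp
    | add y y' hy hy' => simpa only [map_add, mul_add] using hy.add hy'
    | tmul c d =>
      rw [hB]
      refine (hD.tendsto_gammaIntegral a c ⟨_, hD.mul_mem_core b.2 d.2⟩).congr fun n => ?_
      congr 1
      rw [tensorKernel_tmul, tensorKernel_tmul, map_mul]
      ring

theorem IsConservative.exists_tendsto_tensorKernel (hD : D.IsConservative)
    (x y : D.core ⊗[ℝ] D.core) :
    ∃ l, Tendsto (fun n : ℕ => D.jump (n + 1) (D.tensorKernel x * D.tensorKernel y)) atTop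
      (𝓝 l) := by
  induction x with
  | zero => exact ⟨0, by simp⟩
  | add x x' hx hx' =>
    obtain ⟨l, hl⟩ := hx
    obtain ⟨l', hl'⟩ := hx'
    exact ⟨l + l', by simpa only [map_add, add_mul] using hl.add hl'⟩
  | tmul a b =>
    induction y with
    | zero => exact ⟨0, by simp⟩
    | add y y' hy hy' =>
      obtain ⟨l, hl⟩ := hy
      obtain ⟨l', hl'⟩ := hy'
      exact ⟨l + l', by simpa only [map_add, mul_add] using hl.add hl'⟩
    | tmul c d =>
      refine ⟨_, (hD.tendsto_gammaIntegral a c ⟨_, hD.mul_mem_core b.2 d.2⟩).congr fun n => ?_⟩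
      congr 1
      rw [tensorKernel_tmul, tensorKernel_tmul, map_mul]
      ring

/-- The limit of the forms `J_n(k k')` inherits bilinearity and symmetry, and it is nonnegative on
the diagonal because each `J_n` is positive on squares. -/
theorem IsConservative.exists_isTensorForm (hD : D.IsConservative) : ∃ B, D.IsTensorForm B := by
  choose l hl using hD.exists_tendsto_tensorKernel
  refine ⟨LinearMap.mk₂ ℝ l (fun x x' y => ?_) (fun c x y => ?_) (fun x y y' => ?_)
    (fun c x y => ?_), fun x y => ?_, fun x => ?_, fun a b c d => ?_⟩
  · refine tendsto_nhds_unique (hl _ _) ?_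
    simpa only [map_add, add_mul] using (hl x y).add (hl x' y)
  · refine tendsto_nhds_unique (hl _ _) ?_
    simpa only [map_smul, smul_mul_assoc] using (hl x y).const_smul c
  · refine tendsto_nhds_unique (hl _ _) ?_
    simpa only [map_add, mul_add] using (hl x y).add (hl x y')
  · refine tendsto_nhds_unique (hl _ _) ?_
    simpa only [map_smul, mul_smul_comm] using (hl x y).const_smul c
  · refine tendsto_nhds_unique (hl x y) ?_
    simpa only [mul_comm, LinearMap.mk₂_apply] using hl y x
  · refine ge_of_tendsto' (hl x x) fun n => jump_nonneg _ fun z => ?_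
    exact mul_self_nonneg (D.tensorKernel x z)
  · refine tendsto_nhds_unique (hl _ _) ?_
    refine (hD.tendsto_gammaIntegral a c ⟨_, hD.mul_mem_core b.2 d.2⟩).congr fun n => ?_
    congr 1
    rw [tensorKernel_tmul, tensorKernel_tmul, map_mul]
    ring

theorem IsConservative.tensorForm_tmul (hD : D.IsConservative) (a b c d : D.core) :
    D.tensorForm (a ⊗ₜ b) (c ⊗ₜ d) = D.gammaIntegral a c (b.1 * d.1) := by
  rw [tensorForm, dif_pos hD.exists_isTensorForm]
  exact hD.exists_isTensorForm.choose_spec.2.2 a b c d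

/-! ### The space of forms -/

variable (D) in
/-- The map from `𝓒 ⊗ 𝓒` to the Hilbert space of forms. -/
noncomputable def toForms : D.core ⊗[ℝ] D.core →ₗ[ℝ] D.Forms :=
  (UniformSpace.Completion.toComplₗᵢ (𝕜 := ℝ) (E := D.PreForms)).toLinearMap ∘ₗ
    (LinearMap.id : D.core ⊗[ℝ] D.core →ₗ[ℝ] D.core ⊗[ℝ] D.core)

theorem toForms_tmul (a b : D.core) : D.toForms (a ⊗ₜ b) = D.simpleTensor a b := rfl

theorem inner_toForms (x y : D.core ⊗[ℝ] D.core) :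
    inner ℝ (D.toForms x) (D.toForms y) = D.tensorForm x y :=
  UniformSpace.Completion.inner_coe (𝕜 := ℝ) (E := D.PreForms) x y

theorem denseRange_toForms : DenseRange D.toForms :=
  UniformSpace.Completion.denseRange_coe (α := D.PreForms)

theorem IsConservative.inner_simpleTensor (hD : D.IsConservative) (a b c d : D.core) :
    inner ℝ (D.simpleTensor a b) (D.simpleTensor c d) = D.gammaIntegral a c (b.1 * d.1) := by
  rw [← toForms_tmul, ← toForms_tmul, inner_toForms, hD.tensorForm_tmul]

theorem IsConservative.norm_sq_toForms_le (hD : D.IsConservative) (x : D.core ⊗[ℝ] D.core)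
    {h : C(K × K, ℝ)} (hx : ∀ z, D.tensorKernel x z ^ 2 ≤ h z) {c : ℝ}
    (hc : Tendsto (fun n : ℕ => D.jump (n + 1) h) atTop (𝓝 c)) : ‖D.toForms x‖ ^ 2 ≤ c := by
  rw [← real_inner_self_eq_norm_sq, inner_toForms]
  refine le_of_tendsto_of_tendsto' (hD.tendsto_of_forall_tmul _ hD.tensorForm_tmul x x) hc
    fun n => jump_mono fun z => ?_
  have := hx z
  rw [sq] at this
  exact this

variable (D) in
/-- The energy `𝓔(f, f)` of an element of the core. -/
noncomputable def coreEnergy (f : D.core) : ℝ := D.form (D.coreToDomain f) (D.coreToDomain f)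

theorem coreEnergy_nonneg (f : D.core) : 0 ≤ D.coreEnergy f := D.nonneg _

theorem IsConservative.norm_simpleTensor_le (hD : D.IsConservative) (a b : D.core) :
    ‖D.simpleTensor a b‖ ≤ √(D.coreEnergy a) * ‖b.1‖ := by
  refine le_of_sq_le_sq ?_ (by positivity)
  rw [mul_pow, Real.sq_sqrt (coreEnergy_nonneg a), ← toForms_tmul, mul_comm]
  refine hD.norm_sq_toForms_le (h := ‖b.1‖ ^ 2 • (increment a.1 * increment a.1)) _ (fun z => ?_) ?_
  · rw [tensorKernel_tmul]
    simp only [ContinuousMap.mul_apply, ContinuousMap.smul_apply, smul_eq_mul, mul_pow, ← sq]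
    refine mul_le_mul_of_nonneg_right (sq_le_sq.2 ?_) (sq_nonneg _)
    rw [abs_norm]
    exact b.1.norm_coe_le_norm z.1
  · simp only [map_smul]
    exact (hD.tendsto_jump a a).const_smul _

/-! ### Tensors with a continuous second factor -/

theorem IsRegular.denseRange (hreg : D.IsRegular) : DenseRange D.core.subtype := by
  rw [Metric.denseRange_iff]
  intro f ε hε
  obtain ⟨g, hg⟩ := hreg.1 f (HasCompactSupport.of_compactSpace _) (ε / 2) (by positivity)
  refine ⟨g, lt_of_le_of_lt ?_ (half_lt_self hε)⟩
  rw [ContinuousMap.dist_le (by positivity)]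
  exact fun x => (hg x).le

/-- On a compact space the topology of uniform convergence induces the norm topology of `C(K, ℝ)`.
-/
theorem uniformApprox_eq (b : C(K, ℝ)) : D.uniformApprox b = comap D.core.subtype (𝓝 b) := by
  have h : IsInducing (fun f : C(K, ℝ) => UniformFun.ofFun (fun x => f x)) :=
    BoundedContinuousFunction.isInducing_coeFn.comp
      (ContinuousMap.isometryEquivBoundedOfCompact K ℝ).toHomeomorph.isInducing
  rw [h.nhds_eq_comap, comap_comap]
  rfl

theorem IsRegular.neBot_uniformApprox (hreg : D.IsRegular) (b : C(K, ℝ)) :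
    (D.uniformApprox b).NeBot := by
  rw [uniformApprox_eq]
  refine comap_neBot_iff_frequently.2 ?_
  exact mem_closure_iff_frequently.1 (hreg.denseRange b)

variable (D) in
/-- The map `b ↦ a ⊗ b`, for `b ∈ 𝓒`. -/
noncomputable def simpleTensorRight (a : D.core) : D.core →ₗ[ℝ] D.Forms :=
  D.toForms ∘ₗ TensorProduct.mk ℝ D.core D.core a

variable (D) in
/-- The continuous extension of the map `b ↦ a ⊗ b` to continuous functions. -/
noncomputable def tensorRight (a : D.core) : C(K, ℝ) →L[ℝ] D.Forms :=
  (D.simpleTensorRight a).extendOfNorm D.core.subtype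

theorem tensorRight_coe (hD : D.IsConservative) (hreg : D.IsRegular) (a b : D.core) :
    D.tensorRight a b = D.simpleTensor a b :=
  LinearMap.extendOfNorm_eq hreg.denseRange ⟨_, hD.norm_simpleTensor_le a⟩ b

theorem norm_tensorRight_le (hD : D.IsConservative) (hreg : D.IsRegular) (a : D.core)
    (b : C(K, ℝ)) : ‖D.tensorRight a b‖ ≤ √(D.coreEnergy a) * ‖b‖ :=
  LinearMap.norm_extendOfNorm_apply_le hreg.denseRange _ (hD.norm_simpleTensor_le a) b

theorem tendsto_simpleTensor (hD : D.IsConservative) (hreg : D.IsRegular) (a : D.core)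
    (b : C(K, ℝ)) :
    Tendsto (D.simpleTensor a) (D.uniformApprox b) (𝓝 (D.tensorRight a b)) := by
  rw [uniformApprox_eq]
  refine (((D.tensorRight a).continuous.tendsto b).comp tendsto_comap).congr fun b' => ?_
  exact tensorRight_coe hD hreg a b'

theorem tensor_eq (hD : D.IsConservative) (hreg : D.IsRegular) (a : D.core) (b : C(K, ℝ)) :
    D.tensor a b = D.tensorRight a b := by
  have := hreg.neBot_uniformApprox b
  exact (tendsto_simpleTensor hD hreg a b).limUnder_eq

/-! ### Locality -/

/-- The function `u` is `0` on a neighbourhood of the support of `v`, so `𝓔(u, v) = 0`. As `u v =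
0`, the form `𝓔_β(u, v)` is exactly `-2 J_β(u(x) v(y))`. -/
theorem tendsto_jump_of_disjoint (hloc : D.IsStronglyLocal) (u v : D.core)
    (h : Disjoint (tsupport u.1) (tsupport v.1)) :
    Tendsto (fun n : ℕ => D.jump (n + 1) (liftFst u.1 * liftSnd v.1)) atTop (𝓝 0) := by
  have h1 : D.form (D.coreToDomain u) (D.coreToDomain v) = 0 := by
    refine hloc _ _ (tsupport v.1) (tsupport u.1)ᶜ 0 (isClosed_tsupport _)
      (isClosed_tsupport _).isOpen_compl h.symm.subset_compl_right ?_ ?_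
    · rw [coe_coreToDomain]
      filter_upwards [ContinuousMap.coeFn_toLp (p := 2) (𝕜 := ℝ) μ v.1] with x hx hx'
      rw [hx]
      exact image_eq_zero_of_notMem_tsupport hx'
    · rw [coe_coreToDomain]
      filter_upwards [ContinuousMap.coeFn_toLp (p := 2) (𝕜 := ℝ) μ u.1] with x hx hx'
      rw [hx]
      exact image_eq_zero_of_notMem_tsupport hx'
  have h2 := (tendsto_approxForm (D.coreToDomain u) (D.coreToDomain v)).const_mul (-1 / 2)
  rw [h1, mul_zero] at h2
  refine h2.congr fun n => ?_
  rw [coe_coreToDomain, coe_coreToDomain, approxForm_toL2 (by positivity), inner_toL2]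
  have h3 : ∀ x, u.1 x * v.1 x = 0 := fun x => by
    by_cases hx : x ∈ tsupport u.1
    · rw [image_eq_zero_of_notMem_tsupport (h.notMem_of_mem_left hx), mul_zero]
    · rw [image_eq_zero_of_notMem_tsupport hx, zero_mul]
  simp only [h3, integral_zero]
  ring

/-- A function on `K × K` that is locally nonpositive, except near pairs of points that can be
separated by the core, is dominated by a function with asymptotically vanishing jump integral. -/
theorem exists_majorant (hloc : D.IsStronglyLocal) (h : C(K × K, ℝ))
    (hh : ∀ x y, (∀ᶠ z in 𝓝 (x, y), h z ≤ 0) ∨ ∃ u v : D.core, (∀ x, 0 ≤ u.1 x) ∧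
      (∀ x, 0 ≤ v.1 x) ∧ 0 < u.1 x ∧ 0 < v.1 y ∧ Disjoint (tsupport u.1) (tsupport v.1)) :
    ∃ h' : C(K × K, ℝ), h ≤ h' ∧
      Tendsto (fun n : ℕ => D.jump (n + 1) h') atTop (𝓝 0) := by
  obtain ⟨h', -, h1, h2⟩ : ∃ h' : C(K × K, ℝ), 0 ≤ h' ∧ (∀ z ∈ univ, h z ≤ h' z) ∧
      Tendsto (fun n : ℕ => D.jump (n + 1) h') atTop (𝓝 0) := by
    -- Local majorants are patched by compactness of `K × K`. Requiring them to be nonnegative lets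
    -- their sum serve on a union.
    refine isCompact_univ.induction_on (p := fun s => ∃ h' : C(K × K, ℝ), 0 ≤ h' ∧
      (∀ z ∈ s, h z ≤ h' z) ∧ Tendsto (fun n : ℕ => D.jump (n + 1) h') atTop (𝓝 0)) ?_ ?_ ?_ ?_
    · exact ⟨0, le_rfl, by simp, by simp⟩
    · rintro s t hst ⟨h', h0, h1, h2⟩
      exact ⟨h', h0, fun z hz => h1 z (hst hz), h2⟩
    · rintro s t ⟨h₁, h0, h1, h2⟩ ⟨h₁', h0', h1', h2'⟩
      refine ⟨h₁ + h₁', add_nonneg h0 h0', ?_, by simpa using h2.add h2'⟩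
      rintro z (hz | hz)
      · exact (h1 z hz).trans (le_add_of_nonneg_right (h0' z))
      · exact (h1' z hz).trans (le_add_of_nonneg_left (h0 z))
    · rintro ⟨x, y⟩ -
      rcases hh x y with hxy | ⟨u, v, hu, hv, hux, hvy, hd⟩
      · exact ⟨_, mem_nhdsWithin_of_mem_nhds hxy, 0, le_rfl, fun z hz => hz, by simp⟩
      · set k : C(K × K, ℝ) := liftFst u.1 * liftSnd v.1 with hk
        have hk0 : ∀ z, 0 ≤ k z := fun z => mul_nonneg (hu _) (hv _)
        have hkz : 0 < k (x, y) := mul_pos hux hvy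
        -- Near `(x, y)` the product `k` exceeds half its value there, so this multiple of `k`
        -- exceeds `‖h‖`.
        refine ⟨_, mem_nhdsWithin_of_mem_nhds (k.continuous.continuousAt.eventually
          (lt_mem_nhds (half_lt_self hkz))), (‖h‖ / (k (x, y) / 2)) • k, fun z => ?_,
          fun z hz => ?_, ?_⟩
        · exact mul_nonneg (by positivity) (hk0 z)
        · refine (le_abs_self _).trans ((h.norm_coe_le_norm z).trans ?_)
          rw [ContinuousMap.smul_apply, smul_eq_mul, div_mul_eq_mul_div, le_div_iff₀ (by positivity)]
          exact mul_le_mul_of_nonneg_left (le_of_lt hz) (norm_nonneg _)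
        · simpa only [map_smul, smul_zero] using (tendsto_jump_of_disjoint hloc u v hd).const_smul
            (‖h‖ / (k (x, y) / 2))
  exact ⟨h', fun z => h1 z (mem_univ z), h2⟩

end DirichletForm

/-! ### Bump functions of the coordinates: compactness of `K` and separation. -/

theorem isC10_univ_of_hasCompactSupport {m : ℕ} {f : EuclideanSpace ℝ (Fin m) → ℝ}
    (hf : ContDiff ℝ 1 f) (hc : HasCompactSupport f) : IsC10 univ f where
  contDiffOn := hf.contDiffOn
  continuousOn := hf.continuous.continuousOn
  zero_at_infty := by
    simpa using hc.is_zero_at_infty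
  bounded_deriv := by
    obtain ⟨C, hC⟩ := (hc.fderiv (𝕜 := ℝ)).exists_bound_of_continuous
      (hf.continuous_fderiv one_ne_zero)
    exact ⟨C, fun p _ => hC p⟩

namespace CoordinateSequence

section

variable {K : Type*} [MetricSpace K] [MeasurableSpace K] [BorelSpace K]
  {μ : Measure K} [IsFiniteMeasureOnCompacts μ] {D : DirichletForm μ} {m : ℕ}
  (Φ : CoordinateSequence D m)

theorem continuous_toMap : Continuous Φ.toMap :=
  (PiLp.continuous_toLp 2 _).comp (continuous_pi fun i => (Φ.coord i).1.continuous)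

theorem exists_norm_toMap_le : ∃ R : ℝ, 0 < R ∧ ∀ x, ‖Φ.toMap x‖ ≤ R := by
  choose C hC using fun i => (Φ.coord i).2.1.exists_bound_of_continuous (Φ.coord i).1.continuous
  refine ⟨√(∑ i, C i ^ 2) + 1, by positivity, fun x => ?_⟩
  rw [EuclideanSpace.norm_eq]
  refine (Real.sqrt_le_sqrt ?_).trans (le_add_of_nonneg_right zero_le_one)
  gcongr with i
  exact hC i x

/-- The image of `Φ` is bounded, and a bump function equal to `1` on a ball containing it pulls back
to the constant. -/
theorem one_mem_core (Φ : CoordinateSequence D m) : (1 : C(K, ℝ)) ∈ D.core := by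
  obtain ⟨R, hR, hR'⟩ := Φ.exists_norm_toMap_le
  let f : ContDiffBump (0 : EuclideanSpace ℝ (Fin m)) := ⟨R, R + 1, hR, by linarith⟩
  obtain ⟨g, hg⟩ := Φ.comp_mem f (isC10_univ_of_hasCompactSupport f.contDiff f.hasCompactSupport)
  have h : g.1 = 1 := by
    ext x
    rw [hg x]
    exact f.one_of_mem_closedBall (mem_closedBall_zero_iff.2 (hR' x))
  exact h ▸ g.2

theorem compactSpace (Φ : CoordinateSequence D m) : CompactSpace K := by
  have h : HasCompactSupport (1 : C(K, ℝ)) := Φ.one_mem_core.1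
  have h2 : tsupport (1 : C(K, ℝ)) = univ := by
    rw [tsupport, eq_univ_iff_forall]
    exact fun x => subset_closure (by simp)
  exact ⟨h2 ▸ h⟩

end

variable {K : Type*} [MetricSpace K] [MeasurableSpace K] [BorelSpace K] [CompactSpace K]
  {μ : Measure K} [IsFiniteMeasureOnCompacts μ] {D : DirichletForm μ} {m : ℕ}
  (Φ : CoordinateSequence D m)

theorem isConservative (Φ : CoordinateSequence D m) (hloc : D.IsStronglyLocal) : D.IsConservative := by
  refine ⟨Φ.one_mem_core, fun v => hloc _ v univ univ 1 isClosed_univ isOpen_univ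
    (subset_univ _) (by simp) ?_⟩
  rw [DirichletForm.coe_coreToDomain]
  filter_upwards [ContinuousMap.coeFn_toLp (p := 2) (𝕜 := ℝ) μ (1 : C(K, ℝ))] with x hx _
  rw [hx]; rfl

theorem exists_separating {x y : K} (hxy : Φ.toMap x ≠ Φ.toMap y) :
    ∃ u v : D.core, (∀ x, 0 ≤ u.1 x) ∧ (∀ x, 0 ≤ v.1 x) ∧ 0 < u.1 x ∧ 0 < v.1 y ∧
      Disjoint (tsupport u.1) (tsupport v.1) := by
  have hd : 0 < dist (Φ.toMap x) (Φ.toMap y) := dist_pos.2 hxy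
  set d := dist (Φ.toMap x) (Φ.toMap y) with hd'
  have key : ∀ p : EuclideanSpace ℝ (Fin m), ∃ u : D.core, (∀ x, 0 ≤ u.1 x) ∧
      (∀ x, Φ.toMap x = p → 0 < u.1 x) ∧
      tsupport u.1 ⊆ Φ.toMap ⁻¹' Metric.closedBall p (d / 3) := fun p => by
    let f : ContDiffBump p := ⟨d / 4, d / 3, by positivity, by linarith⟩
    obtain ⟨g, hg⟩ := Φ.comp_mem f (isC10_univ_of_hasCompactSupport f.contDiff f.hasCompactSupport)
    refine ⟨g, fun x => by rw [hg]; exact f.nonneg, fun x hx => ?_, ?_⟩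
    · rw [hg]
      refine f.pos_of_mem_ball ?_
      change Φ.toMap x ∈ _
      rw [hx]
      exact Metric.mem_ball_self f.rOut_pos
    · refine closure_minimal (fun x hx => ?_) (Metric.isClosed_closedBall.preimage Φ.continuous_toMap)
      by_contra h
      refine hx ?_
      rw [hg]
      refine f.zero_of_le_dist ?_
      simp only [mem_preimage, Metric.mem_closedBall, not_le] at h
      exact h.le
  obtain ⟨u, hu, hu', hus⟩ := key (Φ.toMap x)
  obtain ⟨v, hv, hv', hvs⟩ := key (Φ.toMap y)
  refine ⟨u, v, hu, hv, hu' x rfl, hv' y rfl, ?_⟩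
  refine Disjoint.mono hus hvs (Disjoint.preimage _ ?_)
  exact Metric.closedBall_disjoint_closedBall (by linarith)

/-! ### The chain rule -/

/-- The partial derivatives of a `C¹` function along the coordinate map. -/
noncomputable def partialDeriv {U : Set (EuclideanSpace ℝ (Fin m))} (hU : IsOpen U)
    (hΦU : range Φ.toMap ⊆ U) {F : EuclideanSpace ℝ (Fin m) → ℝ} (hF : ContDiffOn ℝ 1 F U)
    (i : Fin m) : C(K, ℝ) where
  toFun x := fderiv ℝ F (Φ.toMap x) (EuclideanSpace.single i 1)
  continuous_toFun := by
    have h1 := (hF.continuousOn_fderiv_of_isOpen hU le_rfl).comp_continuous Φ.continuous_toMap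
      fun x => hΦU (mem_range_self x)
    exact h1.clm_apply continuous_const

variable {Φ}

/-- Both points move near pairs with the common image `p`, so strict differentiability of `F` at `p`
is what is needed. The linearization error contributes `ε‖b‖`; each coordinate contributes `2ε`, one
`ε` for freezing `∂ᵢF` at `p` and one for replacing `b ∂ᵢF` by `cᵢ`. -/
theorem tensorKernel_chain_le {U : Set (EuclideanSpace ℝ (Fin m))} (hU : IsOpen U)
    (hΦU : range Φ.toMap ⊆ U) {F : EuclideanSpace ℝ (Fin m) → ℝ} (hF : ContDiffOn ℝ 1 F U)
    (g b : D.core) (hg : ∀ x, g.1 x = F (Φ.toMap x)) {ε : ℝ} (hε : 0 < ε) (c : Fin m → D.core)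
    (hc : ∀ i x, |b.1 x * Φ.partialDeriv hU hΦU hF i x - (c i).1 x| ≤ ε) {x y : K}
    (hxy : Φ.toMap x = Φ.toMap y) :
    ∀ᶠ z in 𝓝 (x, y), D.tensorKernel (g ⊗ₜ b - ∑ i, Φ.coord i ⊗ₜ c i) z ^ 2 ≤
      (ε * (‖b.1‖ + 2 * m)) ^ 2 * ∑ i, (increment (Φ.coord i).1 z) ^ 2 := by
  set p := Φ.toMap x with hp
  set L := fderiv ℝ F p with hL
  have hstrict : HasStrictFDerivAt F L p :=
    (hF.contDiffAt (hU.mem_nhds (hΦU (mem_range_self x)))).hasStrictFDerivAt one_ne_zero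
  have h1 : ∀ᶠ z : K × K in 𝓝 (x, y), ‖F (Φ.toMap z.1) - F (Φ.toMap z.2) -
      L (Φ.toMap z.1 - Φ.toMap z.2)‖ ≤ ε * ‖Φ.toMap z.1 - Φ.toMap z.2‖ := by
    have h2 := hstrict.isLittleO.def hε
    have h3 : Tendsto (fun z : K × K => (Φ.toMap z.1, Φ.toMap z.2)) (𝓝 (x, y)) (𝓝 (p, p)) := by
      have : Continuous fun z : K × K => (Φ.toMap z.1, Φ.toMap z.2) :=
        (Φ.continuous_toMap.comp continuous_fst).prodMk (Φ.continuous_toMap.comp continuous_snd)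
      have h4 := this.tendsto (x, y)
      simp only [← hxy] at h4
      exact h4
    exact h3.eventually h2
  have h2 : ∀ᶠ z : K × K in 𝓝 (x, y), ∀ i,
      |b.1 z.1 * Φ.partialDeriv hU hΦU hF i x - b.1 z.1 * Φ.partialDeriv hU hΦU hF i z.1| < ε := by
    rw [eventually_all]
    intro i
    have : Continuous fun z : K × K =>
      |b.1 z.1 * Φ.partialDeriv hU hΦU hF i x - b.1 z.1 * Φ.partialDeriv hU hΦU hF i z.1| := by
      fun_prop
    refine this.continuousAt.eventually (gt_mem_nhds ?_)
    simpa using hε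
  filter_upwards [h1, h2] with z hz1 hz2
  set d := Φ.toMap z.1 - Φ.toMap z.2 with hd
  have hdi : ∀ i, d i = increment (Φ.coord i).1 z := fun i => rfl
  have hdn : ‖d‖ ^ 2 = ∑ i, (increment (Φ.coord i).1 z) ^ 2 := by
    rw [EuclideanSpace.real_norm_sq_eq]
    exact Finset.sum_congr rfl fun i _ => by rw [hdi]
  have hLd : L d = ∑ i, d i * Φ.partialDeriv hU hΦU hF i x := by
    conv_lhs => rw [← (EuclideanSpace.basisFun (Fin m) ℝ).sum_repr d]
    simp only [map_sum, map_smul, EuclideanSpace.basisFun_repr, EuclideanSpace.basisFun_apply,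
      smul_eq_mul]
    rfl
  rw [← hdn, ← mul_pow, ← sq_abs]
  refine pow_le_pow_left₀ (abs_nonneg _) ?_ 2
  have hK : D.tensorKernel (g ⊗ₜ b - ∑ i, Φ.coord i ⊗ₜ c i) z =
      b.1 z.1 * (F (Φ.toMap z.1) - F (Φ.toMap z.2) - L d) +
        ∑ i, (b.1 z.1 * Φ.partialDeriv hU hΦU hF i x - (c i).1 z.1) * d i := by
    rw [map_sub, map_sum, hLd]
    simp only [DirichletForm.tensorKernel_tmul, ContinuousMap.sub_apply, ContinuousMap.mul_apply,
      ContinuousMap.sum_apply, sub_mul, Finset.sum_sub_distrib, mul_sub, Finset.mul_sum]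
    rw [liftFst_apply, increment_apply, hg, hg]
    have : ∀ i, liftFst (c i).1 z * increment (Φ.coord i).1 z = (c i).1 z.1 * d i := fun i => rfl
    simp only [this]
    have : ∀ i, b.1 z.1 * Φ.partialDeriv hU hΦU hF i x * d i =
      b.1 z.1 * (d i * Φ.partialDeriv hU hΦU hF i x) := fun i => by ring
    simp only [this]
    ring
  rw [hK]
  have hb : |b.1 z.1| ≤ ‖b.1‖ := b.1.norm_coe_le_norm z.1
  calc _ ≤ |b.1 z.1 * (F (Φ.toMap z.1) - F (Φ.toMap z.2) - L d)| +
        |∑ i, (b.1 z.1 * Φ.partialDeriv hU hΦU hF i x - (c i).1 z.1) * d i| := abs_add_le _ _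
    _ ≤ ‖b.1‖ * (ε * ‖d‖) + ∑ _i : Fin m, (2 * ε) * ‖d‖ := by
      gcongr
      · rw [abs_mul]
        gcongr
        exact hz1
      · refine (Finset.abs_sum_le_sum_abs _ _).trans (Finset.sum_le_sum fun i _ => ?_)
        rw [abs_mul]
        have h3 : |d i| ≤ ‖d‖ := PiLp.norm_apply_le d i
        gcongr
        have h4 := hc i z.1
        have h5 := (hz2 i).le
        have h6 := abs_add_le (b.1 z.1 * Φ.partialDeriv hU hΦU hF i x -
          b.1 z.1 * Φ.partialDeriv hU hΦU hF i z.1)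
          (b.1 z.1 * Φ.partialDeriv hU hΦU hF i z.1 - (c i).1 z.1)
        rw [sub_add_sub_cancel] at h6
        linarith
    _ = _ := by
      simp only [Finset.sum_const, Finset.card_univ, Fintype.card_fin, nsmul_eq_mul]
      ring

open DirichletForm in
/-- The chain rule for energy measures. -/
theorem tensorRight_chain (hreg : D.IsRegular) (hloc : D.IsStronglyLocal)
    {U : Set (EuclideanSpace ℝ (Fin m))} (hU : IsOpen U) (hΦU : range Φ.toMap ⊆ U)
    {F : EuclideanSpace ℝ (Fin m) → ℝ} (hF : ContDiffOn ℝ 1 F U) (g b : D.core)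
    (hg : ∀ x, g.1 x = F (Φ.toMap x)) :
    D.tensorRight g b = ∑ i, D.tensorRight (Φ.coord i) (b.1 * Φ.partialDeriv hU hΦU hF i) := by
  have hD := Φ.isConservative hloc
  set E : ℝ := ∑ i, D.coreEnergy (Φ.coord i) with hE
  set A : ℝ := ‖b.1‖ + 2 * m with hA
  set S : ℝ := ∑ i, √(D.coreEnergy (Φ.coord i)) with hS
  have hE0 : 0 ≤ E := Finset.sum_nonneg fun i _ => coreEnergy_nonneg _
  have key : ∀ ε > 0, ‖D.tensorRight g b -
      ∑ i, D.tensorRight (Φ.coord i) (b.1 * Φ.partialDeriv hU hΦU hF i)‖ ≤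
        ε * (A * √E + S) := fun ε hε => by
    -- The partial derivatives are only continuous, while kernels are defined for tensors over `𝓒`;
    -- hence the uniform approximation.
    have hex : ∀ i, ∃ c : D.core, ‖c.1 - b.1 * Φ.partialDeriv hU hΦU hF i‖ ≤ ε := fun i => by
      obtain ⟨c, hc⟩ := Metric.denseRange_iff.1 hreg.denseRange
        (b.1 * Φ.partialDeriv hU hΦU hF i) ε hε
      rw [dist_comm, dist_eq_norm] at hc
      exact ⟨c, hc.le⟩
    choose c hc using hex
    have hc' : ∀ i x, |b.1 x * Φ.partialDeriv hU hΦU hF i x - (c i).1 x| ≤ ε := fun i x => by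
      rw [abs_sub_comm]
      exact ((c i).1 - b.1 * Φ.partialDeriv hU hΦU hF i).norm_coe_le_norm x |>.trans (hc i)
    set t : D.core ⊗[ℝ] D.core := g ⊗ₜ b - ∑ i, Φ.coord i ⊗ₜ c i with ht
    set q : C(K × K, ℝ) := ∑ i, increment (Φ.coord i).1 * increment (Φ.coord i).1 with hq
    have hqz : ∀ z, q z = ∑ i, (increment (Φ.coord i).1 z) ^ 2 := fun z => by
      simp [hq, sq]
    have hqt : Tendsto (fun n : ℕ => D.jump (n + 1) q) atTop (𝓝 E) := by
      simp only [hq, map_sum]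
      exact tendsto_finsetSum _ fun i _ => hD.tendsto_jump _ _
    -- The excess of the squared kernel over `(εA)² q` is nonpositive near pairs with equal image,
    -- and the other pairs are separated by `𝓒`; it is therefore asymptotically negligible.
    obtain ⟨h', hh', hlim⟩ := exists_majorant hloc
      (D.tensorKernel t * D.tensorKernel t - (ε * A) ^ 2 • q) (fun x y => by
        by_cases hxy : Φ.toMap x = Φ.toMap y
        · left
          filter_upwards [tensorKernel_chain_le hU hΦU hF g b hg hε c hc' hxy] with z hz
          rw [← hqz, ← ht, ← hA] at hz
          change D.tensorKernel t z * D.tensorKernel t z - (ε * A) ^ 2 * q z ≤ 0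
          rw [← sq]
          linarith
        · exact Or.inr (Φ.exists_separating hxy))
    have hnorm : ‖D.toForms t‖ ≤ ε * A * √E := by
      refine le_of_sq_le_sq ?_ (by positivity)
      rw [mul_pow, Real.sq_sqrt hE0]
      refine hD.norm_sq_toForms_le t (h := h' + (ε * A) ^ 2 • q) (fun z => ?_) ?_
      · have := hh' z
        change (D.tensorKernel t z * D.tensorKernel t z - (ε * A) ^ 2 * q z) ≤ h' z at this
        change D.tensorKernel t z ^ 2 ≤ h' z + (ε * A) ^ 2 * q z
        rw [sq]
        linarith
      · simpa only [map_add, map_smul, smul_eq_mul, zero_add] using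
          hlim.add (hqt.const_smul ((ε * A) ^ 2))
    have hdecomp : D.tensorRight g b -
        ∑ i, D.tensorRight (Φ.coord i) (b.1 * Φ.partialDeriv hU hΦU hF i) =
        D.toForms t +
          ∑ i, D.tensorRight (Φ.coord i) ((c i).1 - b.1 * Φ.partialDeriv hU hΦU hF i) := by
      simp only [map_sub, Finset.sum_sub_distrib, ht, map_sum, toForms_tmul]
      simp only [← tensorRight_coe hD hreg]
      abel
    rw [hdecomp]
    calc _ ≤ ‖D.toForms t‖ +
          ‖∑ i, D.tensorRight (Φ.coord i) ((c i).1 - b.1 * Φ.partialDeriv hU hΦU hF i)‖ :=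
          norm_add_le _ _
      _ ≤ ε * A * √E + ∑ i, √(D.coreEnergy (Φ.coord i)) * ε := by
        gcongr
        refine (norm_sum_le _ _).trans (Finset.sum_le_sum fun i _ => ?_)
        refine (norm_tensorRight_le hD hreg _ _).trans ?_
        gcongr
        exact hc i
      _ = _ := by rw [← Finset.sum_mul]; ring
  have h0 : Tendsto (fun ε : ℝ => ε * (A * √E + S)) (𝓝[>] 0) (𝓝 0) := by
    have : Tendsto (fun ε : ℝ => ε * (A * √E + S)) (𝓝 0) (𝓝 (0 * (A * √E + S))) :=
      (continuous_id.mul continuous_const).tendsto 0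
    rw [zero_mul] at this
    exact this.mono_left nhdsWithin_le_nhds
  have h1 := ge_of_tendsto h0 (by filter_upwards [self_mem_nhdsWithin] with ε hε using key ε hε)
  exact sub_eq_zero.1 (norm_le_zero_iff.1 h1)

end CoordinateSequence

/-! ### Integrals against signed densities, and gradients. -/

theorem MeasureTheory.integral_withDensityᵥ {X : Type*} [MeasurableSpace X] {μ : Measure X}
    {Z f : X → ℝ} (hZ : Integrable Z μ) (hf : Measurable f) {C : ℝ} (hC : ∀ x, |f x| ≤ C) :
    (μ.withDensityᵥ Z).integral f (ContinuousLinearMap.lsmul ℝ ℝ).flip =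
      ∫ x, f x * Z x ∂μ := by
  have hpos := isFiniteMeasure_withDensity_ofReal hZ.2
  have hneg := isFiniteMeasure_withDensity_ofReal hZ.neg.2
  have hbd : ∀ (ν : Measure X) [IsFiniteMeasure ν], Integrable f ν := fun ν _ =>
    Integrable.of_bound hf.aestronglyMeasurable C (ae_of_all _ hC)
  have hfZ : Integrable (fun x => f x * Z x) μ :=
    hZ.bdd_mul hf.aestronglyMeasurable (ae_of_all _ hC)
  rw [withDensityᵥ_eq_withDensity_pos_part_sub_withDensity_neg_part hZ,
    VectorMeasure.integral_sub_vectorMeasure, VectorMeasure.integral_toSignedMeasure,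
    VectorMeasure.integral_toSignedMeasure, integral_withDensity_eq_integral_toReal_smul₀,
    integral_withDensity_eq_integral_toReal_smul₀, ← integral_sub]
  · refine integral_congr_ae (ae_of_all _ fun x => ?_)
    simp only [smul_eq_mul]
    rcases le_total 0 (Z x) with h | h
    · rw [ENNReal.toReal_ofReal h, ENNReal.ofReal_of_nonpos (by linarith)]
      simp [mul_comm]
    · rw [ENNReal.ofReal_of_nonpos h, ENNReal.toReal_ofReal (by linarith)]
      simp [mul_comm]
  · have h1 : Integrable (fun x => (ENNReal.ofReal (Z x)).toReal) μ := hZ.real_toNNReal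
    simpa only [smul_eq_mul, mul_comm] using
      h1.bdd_mul hf.aestronglyMeasurable (ae_of_all _ hC)
  · have h1 : Integrable (fun x => (ENNReal.ofReal (-Z x)).toReal) μ := hZ.neg.real_toNNReal
    simpa only [smul_eq_mul, mul_comm] using
      h1.bdd_mul hf.aestronglyMeasurable (ae_of_all _ hC)
  · exact hZ.aemeasurable.neg.ennreal_ofReal
  · exact ae_of_all _ fun x => ENNReal.ofReal_lt_top
  · exact hZ.aemeasurable.ennreal_ofReal
  · exact ae_of_all _ fun x => ENNReal.ofReal_lt_top
  · simpa only [VectorMeasure.Integrable, Measure.variation_toSignedMeasure] using hbd _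
  · simpa only [VectorMeasure.Integrable, Measure.variation_toSignedMeasure] using hbd _

theorem gradient_apply {m : ℕ} (F : EuclideanSpace ℝ (Fin m) → ℝ) (p : EuclideanSpace ℝ (Fin m))
    (i : Fin m) : gradient F p i = fderiv ℝ F p (EuclideanSpace.single i 1) := by
  rw [← inner_gradient_left, EuclideanSpace.inner_single_right]
  simp

theorem measurable_gradient {m : ℕ} (F : EuclideanSpace ℝ (Fin m) → ℝ) :
    Measurable (gradient F) :=
  (InnerProductSpace.toDual ℝ _).symm.continuous.measurable.comp (measurable_fderiv ℝ F)

theorem norm_gradient {m : ℕ} (F : EuclideanSpace ℝ (Fin m) → ℝ) (p : EuclideanSpace ℝ (Fin m)) :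
    ‖gradient F p‖ = ‖fderiv ℝ F p‖ :=
  (InnerProductSpace.toDual ℝ _).symm.norm_map _

namespace CoordinateSequence

open DirichletForm

variable {K : Type*} [MetricSpace K] [MeasurableSpace K] [BorelSpace K] [CompactSpace K]
  {μ : Measure K} [IsFiniteMeasureOnCompacts μ] {D : DirichletForm μ} {m : ℕ}
  (Φ : CoordinateSequence D m)

/-! ### Inner products in terms of the densities -/

theorem memLp_two (i j : Fin m) : MemLp (Φ.Z i j) 2 μ := (Φ.memLp_top i j).mono_exponent le_top

theorem integrable_mul_Z (f : C(K, ℝ)) (i j : Fin m) : Integrable (fun x => f x * Φ.Z i j x) μ :=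
  (memLp_one_iff_integrable.1 (Φ.memLp_one i j)).bdd_mul f.continuous.aestronglyMeasurable
    (ae_of_all _ f.norm_coe_le_norm)

theorem gammaIntegral_coord (i j : Fin m) (φ : D.core) :
    D.gammaIntegral (Φ.coord i) (Φ.coord j) φ = ∫ x, φ.1 x * Φ.Z i j x ∂μ := by
  rw [← Φ.isEnergyMeasure i j φ]
  exact integral_withDensityᵥ (memLp_one_iff_integrable.1 (Φ.memLp_one i j))
    φ.1.continuous.measurable φ.1.norm_coe_le_norm

/-- Integration against the density `Zⁱʲ`. -/
noncomputable def integralZ (i j : Fin m) : C(K, ℝ) →L[ℝ] ℝ :=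
  LinearMap.mkContinuous
    { toFun := fun f => ∫ x, f x * Φ.Z i j x ∂μ
      map_add' := fun f g => by
        rw [← integral_add (Φ.integrable_mul_Z f i j) (Φ.integrable_mul_Z g i j)]
        simp only [ContinuousMap.add_apply, add_mul]
      map_smul' := fun c f => by
        simp only [ContinuousMap.smul_apply, smul_eq_mul, mul_assoc, integral_const_mul,
          RingHom.id_apply] }
    (∫ x, |Φ.Z i j x| ∂μ) fun f => by
      have h1 := (memLp_one_iff_integrable.1 (Φ.memLp_one i j)).abs
      refine (norm_integral_le_of_norm_le (h1.const_mul ‖f‖) (ae_of_all _ fun x => ?_)).trans_eq ?_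
      · rw [norm_mul, Real.norm_eq_abs (Φ.Z i j x)]
        gcongr
        exact f.norm_coe_le_norm x
      · rw [integral_const_mul, mul_comm]

theorem integralZ_apply (i j : Fin m) (f : C(K, ℝ)) :
    Φ.integralZ i j f = ∫ x, f x * Φ.Z i j x ∂μ := rfl

variable (hreg : D.IsRegular) (hloc : D.IsStronglyLocal)

include hreg hloc in
theorem inner_tensorRight (i j : Fin m) (b d : C(K, ℝ)) :
    inner ℝ (D.tensorRight (Φ.coord i) b) (D.tensorRight (Φ.coord j) d) =
      ∫ x, b x * d x * Φ.Z i j x ∂μ := by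
  have hD := Φ.isConservative hloc
  change _ = Φ.integralZ i j (b * d)
  refine hreg.denseRange.induction_on₂ (p := fun b d => inner ℝ (D.tensorRight (Φ.coord i) b)
    (D.tensorRight (Φ.coord j) d) = Φ.integralZ i j (b * d)) ?_ (fun b d => ?_) b d
  · exact isClosed_eq (by fun_prop) (by fun_prop)
  · simp only [Submodule.coe_subtype]
    rw [tensorRight_coe hD hreg, tensorRight_coe hD hreg, hD.inner_simpleTensor, integralZ_apply]
    exact Φ.gammaIntegral_coord i j ⟨_, hD.mul_mem_core b.2 d.2⟩

/-- The vector `(Zⁱ¹, …, Zⁱᵐ)`. -/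
noncomputable def zRow (i : Fin m) (y : K) : EuclideanSpace ℝ (Fin m) :=
  WithLp.toLp 2 fun j => Φ.Z i j y

/-- The vector field `∑ᵢⱼ Zⁱʲ bᵢ d xʲ`. -/
noncomputable def dualField (b : Fin m → C(K, ℝ)) (y : K) : EuclideanSpace ℝ (Fin m) :=
  ∑ i, b i y • Φ.zRow i y

theorem dualField_apply (b : Fin m → C(K, ℝ)) (y : K) (j : Fin m) :
    Φ.dualField b y j = ∑ i, b i y * Φ.Z i j y := by
  simp [dualField, zRow]

theorem dualField_eq (b : Fin m → C(K, ℝ)) (y : K) :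
    Φ.dualField b y = ∑ i, ∑ j, (Φ.Z i j y * b i y) • EuclideanSpace.single j (1 : ℝ) := by
  ext k
  rw [dualField_apply]
  simp [mul_comm, Finset.sum_apply, Pi.single_apply]

include hreg hloc in
theorem inner_sum_tensorRight (b d : Fin m → C(K, ℝ)) :
    inner ℝ (∑ i, D.tensorRight (Φ.coord i) (b i)) (∑ j, D.tensorRight (Φ.coord j) (d j)) =
      ∫ y, inner ℝ (Φ.dualField b y) (WithLp.toLp 2 fun j => d j y) ∂μ := by
  have h : ∀ y, inner ℝ (Φ.dualField b y) (WithLp.toLp 2 fun j => d j y) =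
      ∑ i, ∑ j, b i y * d j y * Φ.Z i j y := fun y => by
    rw [PiLp.inner_apply, Finset.sum_comm]
    refine Finset.sum_congr rfl fun j _ => ?_
    rw [dualField_apply]
    simp only [RCLike.inner_apply, conj_trivial, Finset.mul_sum]
    exact Finset.sum_congr rfl fun i _ => by ring
  have hint : ∀ i j, Integrable (fun y => b i y * d j y * Φ.Z i j y) μ := fun i j =>
    Φ.integrable_mul_Z (b i * d j) i j
  simp only [h, sum_inner, inner_sum, Φ.inner_tensorRight hreg hloc]
  rw [integral_finsetSum _ fun i _ => integrable_finsetSum _ fun j _ => hint i j, Finset.sum_comm]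
  exact Finset.sum_congr rfl fun i _ => (integral_finsetSum _ fun j _ => hint i j).symm

/-! ### The densities annihilate the conormal spaces -/

variable {U : Set (EuclideanSpace ℝ (Fin m))} (hU : IsOpen U) (hΦU : range Φ.toMap ⊆ U)

variable (U) in
/-- The ideal of `C¹₀(U)` functions that vanish on the image of the coordinate map. -/
def vanishingIdeal : Set (EuclideanSpace ℝ (Fin m) → ℝ) :=
  {f | IsC10 U f ∧ ∀ q ∈ range Φ.toMap, f q = 0}

include hU hΦU in
-- The fields `∇f ∘ Φ` lie in the separable space `C(K, ℝᵐ)`, and orthogonality to `w` at `y` is a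
-- closed condition on them. Almost-everywhere statements for each `f` thus combine into one for the
-- whole ideal.
theorem exists_countable_vanishingIdeal : ∃ T ⊆ Φ.vanishingIdeal U, T.Countable ∧
    ∀ (y : K) (w : EuclideanSpace ℝ (Fin m)),
      (∀ f ∈ T, inner ℝ (gradient f (Φ.toMap y)) w = 0) →
        w ∈ (dIdeal U (range Φ.toMap) (Φ.toMap y))ᗮ := by
  have hcont : ∀ f ∈ Φ.vanishingIdeal U, Continuous fun y => gradient f (Φ.toMap y) :=
    fun f hf => (InnerProductSpace.toDual ℝ _).symm.continuous.comp
      ((hf.1.contDiffOn.continuousOn_fderiv_of_isOpen hU le_rfl).comp_continuous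
        Φ.continuous_toMap fun x => hΦU (mem_range_self x))
  let G : Φ.vanishingIdeal U → C(K, EuclideanSpace ℝ (Fin m)) := fun f => ⟨_, hcont f f.2⟩
  obtain ⟨t, ht, htc, htd⟩ := (TopologicalSpace.IsSeparable.of_separableSpace
    (range G)).exists_countable_dense_subset
  choose σ hσ using fun g : t => ht g.2
  have := htc.to_subtype
  refine ⟨range fun g => (σ g).1, ?_, countable_range _, fun y w hw => ?_⟩
  · rintro _ ⟨g, rfl⟩
    exact (σ g).2
  · have h1 : ∀ g ∈ closure t, inner ℝ (g y) w = 0 := by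
      have hcl : IsClosed {g : C(K, EuclideanSpace ℝ (Fin m)) | inner ℝ (g y) w = 0} :=
        isClosed_eq ((continuous_eval_const y).inner continuous_const)
          continuous_const
      refine hcl.closure_subset_iff.2 fun g hg => ?_
      have := hw _ ⟨⟨g, hg⟩, rfl⟩
      rw [← show G (σ ⟨g, hg⟩) = g from hσ ⟨g, hg⟩]
      exact this
    have h2 : dIdeal U (range Φ.toMap) (Φ.toMap y) ≤ (ℝ ∙ w)ᗮ := by
      refine Submodule.span_le.2 ?_
      rintro _ ⟨f, hf, hf0, rfl⟩
      rw [SetLike.mem_coe, Submodule.mem_orthogonal_singleton_iff_inner_left]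
      exact h1 (G ⟨f, hf, hf0⟩) (htd (mem_range_self _))
    rw [Submodule.mem_orthogonal]
    intro v hv
    exact (Submodule.mem_orthogonal_singleton_iff_inner_left).1 (h2 hv)

include hreg hloc hU hΦU in
-- The chain rule for `f ∘ Φ = 0` with `b = 1` gives `∑ φʲ ⊗ (∂ⱼf ∘ Φ) = 0`. Pairing with `φⁱ ⊗ d`
-- shows that `∑ⱼ ∂ⱼf Zⁱʲ` is orthogonal in `L²` to every continuous `d`.
theorem ae_inner_gradient_zRow {f : EuclideanSpace ℝ (Fin m) → ℝ}
    (hf : f ∈ Φ.vanishingIdeal U) (i : Fin m) :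
    ∀ᵐ y ∂μ, inner ℝ (gradient f (Φ.toMap y)) (Φ.zRow i y) = 0 := by
  have hD := Φ.isConservative hloc
  set γ := Φ.partialDeriv hU hΦU hf.1.contDiffOn with hγ
  have h1 := tensorRight_chain hreg hloc hU hΦU hf.1.contDiffOn 0 ⟨1, Φ.one_mem_core⟩
    fun x => (hf.2 _ (mem_range_self x)).symm
  have h2 : D.tensorRight 0 (1 : C(K, ℝ)) = 0 := by
    have := norm_tensorRight_le hD hreg 0 (1 : C(K, ℝ))
    rw [coreEnergy, map_zero, map_zero, Real.sqrt_zero, zero_mul] at this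
    exact norm_le_zero_iff.1 this
  rw [h2] at h1
  simp only [one_mul] at h1
  have hpt : ∀ y, inner ℝ (gradient f (Φ.toMap y)) (Φ.zRow i y) = ∑ j, γ j y * Φ.Z i j y := by
    intro y
    rw [PiLp.inner_apply]
    refine Finset.sum_congr rfl fun j _ => ?_
    rw [gradient_apply]
    simp only [RCLike.inner_apply, conj_trivial, mul_comm]
    rfl
  have hmem : MemLp (fun y => ∑ j, γ j y * Φ.Z i j y) 2 μ :=
    memLp_finsetSum _ fun j _ => (Φ.memLp_two i j).mul (p := ∞) (ContinuousMap.memLp μ ℝ (γ j))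
  have h3 : hmem.toLp = 0 := by
    refine (ContinuousMap.toLp_denseRange ℝ μ ℝ (p := 2) (by simp)).eq_zero_of_inner_left ℝ ?_
    intro d
    rw [real_inner_comm, inner_toL2_left]
    have h4 : inner ℝ (D.tensorRight (Φ.coord i) d) (∑ j, D.tensorRight (Φ.coord j) (γ j)) = 0 := by
      rw [← h1, inner_zero_right]
    rw [inner_sum] at h4
    simp only [Φ.inner_tensorRight hreg hloc] at h4
    have hint : ∀ j, Integrable (fun x => d x * γ j x * Φ.Z i j x) μ :=
      fun j => Φ.integrable_mul_Z (d * γ j) i j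
    rw [← integral_finsetSum _ fun j _ => hint j] at h4
    rw [← h4]
    refine integral_congr_ae ?_
    filter_upwards [hmem.coeFn_toLp] with y hy
    rw [hy, Finset.mul_sum]
    exact Finset.sum_congr rfl fun j _ => by rw [mul_assoc]
  have h4 := hmem.coeFn_toLp
  rw [h3] at h4
  filter_upwards [h4, Lp.coeFn_zero ℝ 2 μ] with y h5 h6
  rw [hpt, ← h5, h6]
  rfl

include hreg hloc hU hΦU in
theorem ae_zRow_mem_orthogonal :
    ∀ᵐ y ∂μ, ∀ i, Φ.zRow i y ∈ (dIdeal U (range Φ.toMap) (Φ.toMap y))ᗮ := by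
  obtain ⟨T, hT, hTc, hT'⟩ := Φ.exists_countable_vanishingIdeal hU hΦU
  have h : ∀ᵐ y ∂μ, ∀ f ∈ T, ∀ i, inner ℝ (gradient f (Φ.toMap y)) (Φ.zRow i y) = 0 := by
    refine (ae_ball_iff hTc).2 fun f hf => ?_
    exact ae_all_iff.2 fun i => Φ.ae_inner_gradient_zRow hreg hloc hU hΦU (hT hf) i
  filter_upwards [h] with y hy i
  exact hT' y _ fun f hf => hy f hf i

include hreg hloc hU hΦU in
theorem ae_dualField_mem_orthogonal :
    ∀ᵐ y ∂μ, ∀ b, Φ.dualField b y ∈ (dIdeal U (range Φ.toMap) (Φ.toMap y))ᗮ := by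
  filter_upwards [Φ.ae_zRow_mem_orthogonal hreg hloc hU hΦU] with y hy b
  exact Submodule.sum_mem _ fun i _ => Submodule.smul_mem _ _ (hy i)

/-! ### Square integrable forms -/

theorem measurePreserving_toMap : MeasurePreserving Φ.toMap μ (μ.map Φ.toMap) :=
  ⟨Φ.continuous_toMap.measurable, rfl⟩

theorem ae_mem_range : ∀ᵐ p ∂(μ.map Φ.toMap), p ∈ range Φ.toMap := by
  have h : MeasurableSet {p | p ∈ range Φ.toMap} :=
    (isCompact_range Φ.continuous_toMap).isClosed.measurableSet
  exact (ae_map_iff Φ.continuous_toMap.aemeasurable h).2 (ae_of_all _ fun x => mem_range_self x)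

include hU hΦU in
theorem mem_L2Forms_of_ae_inner_eq_zero (v : Lp (EuclideanSpace ℝ (Fin m)) 2 (μ.map Φ.toMap))
    (hv : ∀ f ∈ Φ.vanishingIdeal U, ∀ᵐ p ∂(μ.map Φ.toMap), inner ℝ (gradient f p) (v p) = 0) :
    v ∈ L2Forms U (range Φ.toMap) (μ.map Φ.toMap) := by
  obtain ⟨T, hT, hTc, hT'⟩ := Φ.exists_countable_vanishingIdeal hU hΦU
  have h : ∀ᵐ p ∂(μ.map Φ.toMap), ∀ f ∈ T, inner ℝ (gradient f p) (v p) = 0 :=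
    (ae_ball_iff hTc).2 fun f hf => hv f (hT hf)
  change ∀ᵐ p ∂(μ.map Φ.toMap), v p ∈ (dIdeal U (range Φ.toMap) p)ᗮ
  filter_upwards [h, Φ.ae_mem_range] with p hp hpr
  obtain ⟨y, rfl⟩ := hpr
  exact hT' y _ hp

end CoordinateSequence

/-! ### Orthogonal decomposition of square integrable fields. -/

/-- The square integrable fields with values in `d_p(𝓘_S)`. -/
def conormalFields {m : ℕ} (U S : Set (EuclideanSpace ℝ (Fin m)))
    (ν : Measure (EuclideanSpace ℝ (Fin m))) : Submodule ℝ (Lp (EuclideanSpace ℝ (Fin m)) 2 ν) where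
  carrier := {v | ∀ᵐ p ∂ν, v p ∈ dIdeal U S p}
  zero_mem' := by
    filter_upwards [Lp.coeFn_zero (EuclideanSpace ℝ (Fin m)) 2 ν] with p hp
    rw [hp]
    exact Submodule.zero_mem _
  add_mem' {v w} hv hw := by
    change ∀ᵐ p ∂ν, (v + w) p ∈ dIdeal U S p
    filter_upwards [Lp.coeFn_add v w, hv, hw] with p hp h1 h2
    rw [hp]
    exact Submodule.add_mem _ h1 h2
  smul_mem' c v hv := by
    change ∀ᵐ p ∂ν, (c • v) p ∈ dIdeal U S p
    filter_upwards [Lp.coeFn_smul c v, hv] with p hp h1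
    rw [hp]
    exact Submodule.smul_mem _ c h1

section ConormalFields

variable {m : ℕ} {U S : Set (EuclideanSpace ℝ (Fin m))} {ν : Measure (EuclideanSpace ℝ (Fin m))}

theorem mem_conormalFields (v : Lp (EuclideanSpace ℝ (Fin m)) 2 ν) :
    v ∈ conormalFields U S ν ↔ ∀ᵐ p ∂ν, v p ∈ dIdeal U S p := Iff.rfl

theorem isClosed_conormalFields :
    IsClosed (conormalFields U S ν : Set (Lp (EuclideanSpace ℝ (Fin m)) 2 ν)) := by
  refine IsSeqClosed.isClosed fun v w hv hw => ?_
  obtain ⟨ns, -, hns⟩ := (tendstoInMeasure_of_tendsto_Lp hw).exists_seq_tendsto_ae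
  have hv' : ∀ᵐ p ∂ν, ∀ n, v n p ∈ dIdeal U S p := ae_all_iff.2 fun n => hv n
  change ∀ᵐ p ∂ν, w p ∈ dIdeal U S p
  filter_upwards [hns, hv'] with p h1 h2
  exact (Submodule.closed_of_finiteDimensional _).mem_of_tendsto h1
    (Eventually.of_forall fun i => h2 _)

instance : CompleteSpace (conormalFields U S ν) := isClosed_conormalFields.completeSpace_coe

theorem conormalFields_le_orthogonal : conormalFields U S ν ≤ (L2Forms U S ν)ᗮ := by
  intro w hw
  rw [Submodule.mem_orthogonal]
  intro v hv
  rw [L2.inner_def]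
  refine integral_eq_zero_of_ae ?_
  filter_upwards [hv, (mem_conormalFields w).1 hw] with p h1 h2
  exact Submodule.inner_left_of_mem_orthogonal h2 h1

end ConormalFields

namespace CoordinateSequence

open DirichletForm

variable {K : Type*} [MetricSpace K] [MeasurableSpace K] [BorelSpace K] [CompactSpace K]
  {μ : Measure K} [IsFiniteMeasureOnCompacts μ] {D : DirichletForm μ} {m : ℕ}
  (Φ : CoordinateSequence D m) {U : Set (EuclideanSpace ℝ (Fin m))}

/-- By closedness of the conormal fields it is enough that a field `v` orthogonal to them lies in
`L2Forms`. Testing against `⟨∇f, v⟩ ∇f`, which is square integrable because `∇f` is bounded on `U`,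
gives `∫ ⟨∇f, v⟩² = 0`. No measurable choice of pointwise projections is involved. -/
theorem orthogonal_L2Forms_le (hU : IsOpen U) (hΦU : range Φ.toMap ⊆ U) :
    (L2Forms U (range Φ.toMap) (μ.map Φ.toMap))ᗮ ≤
      conormalFields U (range Φ.toMap) (μ.map Φ.toMap) := by
  rw [← Submodule.orthogonal_orthogonal (conormalFields U (range Φ.toMap) (μ.map Φ.toMap))]
  refine Submodule.orthogonal_le fun v hv => ?_
  refine Φ.mem_L2Forms_of_ae_inner_eq_zero hU hΦU v fun f hf => ?_
  obtain ⟨C, hC⟩ := hf.1.bounded_deriv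
  have hCp : ∀ p ∈ U, ‖gradient f p‖ ≤ C := fun p hp => (norm_gradient f p).trans_le (hC p hp)
  have hg := (measurable_gradient f).aestronglyMeasurable (μ := μ.map Φ.toMap)
  have hmeas : AEStronglyMeasurable (fun p => inner ℝ (gradient f p) (v p) • gradient f p)
      (μ.map Φ.toMap) := (hg.inner (𝕜 := ℝ) (Lp.aestronglyMeasurable v)).smul hg
  have hmem : MemLp (fun p => inner ℝ (gradient f p) (v p) • gradient f p) 2 (μ.map Φ.toMap) := by
    refine MemLp.of_le_mul (c := C * C) (Lp.memLp v) hmeas ?_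
    filter_upwards [Φ.ae_mem_range] with p hp
    have h1 := hCp p (hΦU hp)
    have h0 : 0 ≤ C := (norm_nonneg _).trans h1
    rw [norm_smul]
    calc _ ≤ (‖gradient f p‖ * ‖v p‖) * ‖gradient f p‖ := by
          gcongr
          exact norm_inner_le_norm _ _
      _ ≤ (C * ‖v p‖) * C := by gcongr
      _ = _ := by ring
  have h1 : hmem.toLp ∈ conormalFields U (range Φ.toMap) (μ.map Φ.toMap) := by
    rw [mem_conormalFields]
    filter_upwards [hmem.coeFn_toLp] with p hp
    rw [hp]
    exact Submodule.smul_mem _ _ (Submodule.subset_span ⟨f, hf.1, hf.2, rfl⟩)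
  have h2 := Submodule.inner_right_of_mem_orthogonal h1 hv
  rw [L2.inner_def] at h2
  have h3 : ∀ᵐ p ∂(μ.map Φ.toMap), inner ℝ (hmem.toLp _ p) (v p) =
      inner ℝ (gradient f p) (v p) ^ 2 := by
    filter_upwards [hmem.coeFn_toLp] with p hp
    rw [hp, real_inner_smul_left, sq]
  rw [integral_congr_ae h3] at h2
  have h4 := (integral_eq_zero_iff_of_nonneg_ae (ae_of_all _ fun p => sq_nonneg _)
    ((L2.integrable_inner (hmem.toLp _) v).congr h3)).1 h2
  filter_upwards [h4] with p hp
  exact pow_eq_zero_iff two_ne_zero |>.1 hp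

/-! ### Functions of the coordinates -/

theorem continuous_of_isC10_univ {F : EuclideanSpace ℝ (Fin m) → ℝ} (hF : IsC10 univ F) :
    Continuous F := by
  have := hF.continuousOn
  rwa [closure_univ, continuousOn_univ] at this

theorem norm_coreToDomain_sub_sq_le (f g : D.core) :
    ‖toL2 μ f.1 - toL2 μ g.1‖ ^ 2 ≤ D.energyOne (D.coreToDomain f - D.coreToDomain g) := by
  rw [energyOne, Submodule.coe_sub, coe_coreToDomain, coe_coreToDomain]
  have := D.nonneg (D.coreToDomain f - D.coreToDomain g)
  linarith

/-- Square integrable functions on `K` are almost everywhere functions of the coordinates. -/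
theorem exists_comp_toMap_eq (hreg : D.IsRegular) (g : K → ℝ) (hg : MemLp g 2 μ) :
    ∃ h : EuclideanSpace ℝ (Fin m) → ℝ, MemLp h 2 (μ.map Φ.toMap) ∧ h ∘ Φ.toMap =ᵐ[μ] g := by
  let L := Lp.compMeasurePreservingₗᵢ (E := ℝ) (p := 2) ℝ Φ.toMap Φ.measurePreserving_toMap
  -- Composition with `Φ` is isometric, so its range is closed; it is dense because `C¹(Φ)` is dense
  -- in `𝓒`, `𝓒` in `𝓕` and `𝓕` in `L²`. Injectivity of `Φ` is not needed.
  have hcl : IsClosed (range L) := L.isometry.isClosedEmbedding.isClosed_range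
  have hdense : DenseRange L := by
    rw [Metric.denseRange_iff]
    intro u ε hε
    have hε3 : 0 < ε / 3 := by positivity
    obtain ⟨v, hv, huv⟩ := Metric.dense_iff.1 D.dense_domain u (ε / 3) hε3
    lift v to D.domain using huv
    obtain ⟨f, hf⟩ := hreg.2 v ((ε / 3) ^ 2) (by positivity)
    obtain ⟨F, hF, g, hgF, hfg⟩ := Φ.dense f ((ε / 3) ^ 2) (by positivity)
    have hFm : MemLp F 2 (μ.map Φ.toMap) := by
      rw [memLp_map_measure_iff (continuous_of_isC10_univ hF).aestronglyMeasurable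
        Φ.continuous_toMap.aemeasurable]
      refine (ContinuousMap.memLp μ ℝ g.1).ae_eq (ae_of_all _ fun x => hgF x)
    have hL : L hFm.toLp = toL2 μ g.1 := by
      refine Lp.ext ?_
      have h1 := Lp.coeFn_compMeasurePreserving hFm.toLp Φ.measurePreserving_toMap
      have h2 := ae_of_ae_map Φ.continuous_toMap.aemeasurable hFm.coeFn_toLp
      filter_upwards [h1, h2, ContinuousMap.coeFn_toLp (p := 2) (𝕜 := ℝ) μ g.1] with x h3 h4 h5
      rw [h5, hgF x]
      exact h3.trans h4
    refine ⟨hFm.toLp, ?_⟩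
    rw [hL]
    have h1 : dist u v < ε / 3 := by rw [dist_comm]; exact hv
    have h2 : dist (v : Lp ℝ 2 μ) (toL2 μ f.1) < ε / 3 := by
      rw [dist_eq_norm]
      refine lt_of_pow_lt_pow_left₀ 2 hε3.le (lt_of_le_of_lt ?_ hf)
      rw [energyOne, Submodule.coe_sub, coe_coreToDomain]
      have := D.nonneg (v - D.coreToDomain f)
      linarith
    have h3 : dist (toL2 μ f.1) (toL2 μ g.1) < ε / 3 := by
      rw [dist_eq_norm]
      exact lt_of_pow_lt_pow_left₀ 2 hε3.le ((norm_coreToDomain_sub_sq_le f g).trans_lt hfg)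
    linarith [dist_triangle4 u (v : Lp ℝ 2 μ) (toL2 μ f.1) (toL2 μ g.1)]
  obtain ⟨h, hh⟩ : hg.toLp ∈ range L := by
    rw [← hcl.closure_eq]
    exact hdense _
  refine ⟨h, Lp.memLp h, ?_⟩
  have h1 := Lp.coeFn_compMeasurePreserving h Φ.measurePreserving_toMap
  have h2 := hg.coeFn_toLp
  rw [← hh] at h2
  exact h1.symm.trans h2

end CoordinateSequence

/-! ### Adjoints and closability. -/

theorem ZeroAtInftyContinuousMap.norm_apply_le {X E : Type*} [TopologicalSpace X]
    [NormedAddCommGroup E] (f : C₀(X, E)) (x : X) : ‖f x‖ ≤ ‖f‖ := by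
  rw [← ZeroAtInftyContinuousMap.norm_toBCF_eq_norm]
  exact f.toBCF.norm_coe_le_norm x

/-- An operator whose adjoint is densely defined is closable. -/
theorem LinearPMap.isClosable_of_dense_adjoint_domain {E F : Type*} [NormedAddCommGroup E]
    [InnerProductSpace ℝ E] [CompleteSpace E] [NormedAddCommGroup F] [InnerProductSpace ℝ F]
    (T : E →ₗ.[ℝ] F) (hT : Dense (T.domain : Set E)) (hT' : Dense (T.adjoint.domain : Set F)) :
    T.IsClosable := by
  refine ⟨T.graph.topologicalClosure.toLinearPMap, (Submodule.toLinearPMap_graph_eq _ ?_).symm⟩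
  rintro ⟨x, y⟩ hxy (rfl : x = 0)
  refine hT'.eq_zero_of_inner_left ℝ fun z hz => ?_
  -- The adjoint relation is closed and so passes to the closure of the graph; at `x = 0` it says
  -- that `y` is orthogonal to the dense set of all `z`.
  have hcl : _root_.IsClosed {q : E × F | inner ℝ q.2 z = inner ℝ q.1 (T.adjoint ⟨z, hz⟩)} :=
    isClosed_eq (by fun_prop) (by fun_prop)
  have h : (T.graph : Set (E × F)) ⊆
      {q : E × F | inner ℝ q.2 z = inner ℝ q.1 (T.adjoint ⟨z, hz⟩)} := by
    rintro ⟨a, b⟩ hab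
    obtain ⟨v, rfl, rfl⟩ := T.mem_graph_iff.1 hab
    have h := LinearPMap.adjoint_isFormalAdjoint hT ⟨z, hz⟩ v
    rw [mem_ofPred_eq, real_inner_comm, real_inner_comm _ (v : E)]
    exact h.symm
  have h1 := hcl.closure_subset_iff.2 h hxy
  simpa using h1

theorem LinearPMap.exists_adjoint_eq {E F : Type*} [NormedAddCommGroup E]
    [InnerProductSpace ℝ E] [CompleteSpace E] [NormedAddCommGroup F] [InnerProductSpace ℝ F]
    {T : E →ₗ.[ℝ] F} (hT : Dense (T.domain : Set E)) {y : F} {w : E}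
    (h : ∀ x : T.domain, inner ℝ w (x : E) = inner ℝ y (T x)) :
    ∃ hy : y ∈ T.adjoint.domain, T.adjoint ⟨y, hy⟩ = w :=
  ⟨T.mem_adjoint_domain_of_exists _ ⟨w, h⟩, LinearPMap.adjoint_apply_eq hT _ h⟩

namespace CoordinateSequence

open DirichletForm

variable {K : Type*} [MetricSpace K] [MeasurableSpace K] [BorelSpace K] [CompactSpace K]
  {μ : Measure K} [IsFiniteMeasureOnCompacts μ] {D : DirichletForm μ} {m : ℕ}
  (Φ : CoordinateSequence D m) {U : Set (EuclideanSpace ℝ (Fin m))}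

/-! ### The map `π` -/

/-- The function `ωᵢ ∘ Φ`. -/
noncomputable def pullCoeff (hΦU : range Φ.toMap ⊆ U) (ω : CForms U) (i : Fin m) : C(K, ℝ) where
  toFun x := ω ⟨Φ.toMap x, subset_closure (hΦU (mem_range_self x))⟩ i
  continuous_toFun := by
    have h1 : Continuous fun x => ω ⟨Φ.toMap x, subset_closure (hΦU (mem_range_self x))⟩ :=
      ω.continuous.comp (Φ.continuous_toMap.subtype_mk _)
    exact (EuclideanSpace.proj (𝕜 := ℝ) i).continuous.comp h1

theorem pullCoeff_apply (hΦU : range Φ.toMap ⊆ U) (ω : CForms U) (i : Fin m) (x : K) :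
    Φ.pullCoeff hΦU ω i x = ω ⟨Φ.toMap x, subset_closure (hΦU (mem_range_self x))⟩ i := rfl

theorem norm_pullCoeff_le (hΦU : range Φ.toMap ⊆ U) (ω : CForms U) (i : Fin m) :
    ‖Φ.pullCoeff hΦU ω i‖ ≤ ‖ω‖ := by
  rw [ContinuousMap.norm_le _ (norm_nonneg _)]
  exact fun x => (PiLp.norm_apply_le _ i).trans (ω.norm_apply_le _)

/-- The map `∑ ωᵢ dxⁱ ↦ ∑ φⁱ ⊗ (ωᵢ ∘ Φ)`. -/
noncomputable def pullForm (hreg : D.IsRegular) (hloc : D.IsStronglyLocal)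
    (hΦU : range Φ.toMap ⊆ U) : CForms U →L[ℝ] D.Forms :=
  LinearMap.mkContinuous
    { toFun := fun ω => ∑ i, D.tensorRight (Φ.coord i) (Φ.pullCoeff hΦU ω i)
      map_add' := fun ω η => by
        rw [← Finset.sum_add_distrib]
        refine Finset.sum_congr rfl fun i _ => ?_
        rw [← map_add]
        rfl
      map_smul' := fun c ω => by
        rw [Finset.smul_sum]
        refine Finset.sum_congr rfl fun i _ => ?_
        rw [RingHom.id_apply, ← map_smul]
        rfl }
    (∑ i, √(D.coreEnergy (Φ.coord i))) fun ω => by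
      rw [Finset.sum_mul]
      change ‖∑ i, D.tensorRight (Φ.coord i) (Φ.pullCoeff hΦU ω i)‖ ≤ _
      refine (norm_sum_le _ _).trans (Finset.sum_le_sum fun i _ => ?_)
      refine (norm_tensorRight_le (Φ.isConservative hloc) hreg _ _).trans ?_
      gcongr
      exact Φ.norm_pullCoeff_le hΦU ω i

theorem pullForm_apply (hreg : D.IsRegular) (hloc : D.IsStronglyLocal)
    (hΦU : range Φ.toMap ⊆ U) (ω : CForms U) : Φ.pullForm hreg hloc hΦU ω =
      ∑ i, D.tensorRight (Φ.coord i) (Φ.pullCoeff hΦU ω i) := rfl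

theorem pullForm_eq_sum_tensor (hreg : D.IsRegular) (hloc : D.IsStronglyLocal)
    (hΦU : range Φ.toMap ⊆ U) (ω : CForms U) : Φ.pullForm hreg hloc hΦU ω =
      ∑ i, D.tensor (Φ.coord i)
        (fun x => ω ⟨Φ.toMap x, subset_closure (hΦU (mem_range_self x))⟩ i) := by
  rw [pullForm_apply]
  exact Finset.sum_congr rfl fun i _ =>
    (tensor_eq (Φ.isConservative hloc) hreg (Φ.coord i) (Φ.pullCoeff hΦU ω i)).symm

theorem inner_sum_tensorRight_pullForm (hreg : D.IsRegular) (hloc : D.IsStronglyLocal)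
    (hΦU : range Φ.toMap ⊆ U) (b : Fin m → C(K, ℝ)) (ω : CForms U) :
    inner ℝ (∑ i, D.tensorRight (Φ.coord i) (b i)) (Φ.pullForm hreg hloc hΦU ω) =
      ∫ y, inner ℝ (Φ.dualField b y)
        (ω ⟨Φ.toMap y, subset_closure (hΦU (mem_range_self y))⟩) ∂μ := by
  rw [pullForm_apply, Φ.inner_sum_tensorRight hreg hloc]
  rfl

/-- `‖π ω‖²` is the integral of the pairing of `ω` with its own dual field, which is almost
everywhere orthogonal to `d_p 𝓘`. -/
theorem pullForm_eq_zero (hreg : D.IsRegular) (hloc : D.IsStronglyLocal) (hU : IsOpen U)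
    (hΦU : range Φ.toMap ⊆ U) (ω : CForms U)
    (h : ∀ᵐ y ∂μ, ω ⟨Φ.toMap y, subset_closure (hΦU (mem_range_self y))⟩ ∈
      dIdeal U (range Φ.toMap) (Φ.toMap y)) : Φ.pullForm hreg hloc hΦU ω = 0 := by
  rw [← inner_self_eq_zero (𝕜 := ℝ)]
  have h1 := Φ.inner_sum_tensorRight_pullForm hreg hloc hΦU (Φ.pullCoeff hΦU ω) ω
  rw [← pullForm_apply Φ hreg hloc] at h1
  rw [h1]
  refine integral_eq_zero_of_ae ?_
  filter_upwards [h, Φ.ae_dualField_mem_orthogonal hreg hloc hU hΦU] with y h2 h3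
  exact Submodule.inner_left_of_mem_orthogonal h2 (h3 _)

/-- The form `F dxⁱ` for a function `F` that vanishes at infinity. -/
noncomputable def singleForm {F : EuclideanSpace ℝ (Fin m) → ℝ} (hF : IsC10 univ F) (i : Fin m) :
    CForms U where
  toFun p := EuclideanSpace.single i (F p)
  continuous_toFun := by
    have h := (continuous_of_isC10_univ hF).comp (continuous_subtype_val (p := (· ∈ closure U)))
    have h2 : Continuous fun t : ℝ => (EuclideanSpace.single i t : EuclideanSpace ℝ (Fin m)) := by
      simp only [EuclideanSpace.single]
      exact (PiLp.continuous_toLp 2 _).comp (continuous_single (A := fun _ : Fin m => ℝ) i)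
    exact h2.comp h
  zero_at_infty' := by
    have h := hF.zero_at_infty
    rw [closure_univ, principal_univ, inf_top_eq] at h
    have h1 := h.comp isClosed_closure.isClosedEmbedding_subtypeVal.tendsto_cocompact
      (x := cocompact (closure U))
    rw [tendsto_zero_iff_norm_tendsto_zero]
    simp only [PiLp.norm_single]
    exact tendsto_zero_iff_norm_tendsto_zero.1 h1

/-- Approximation of `c` by `C¹(Φ)` is available in `𝓔₁` but not assumed uniform. The bound `Zⁱⁱ ≤
M` repairs this: `‖φⁱ ⊗ d‖² = ∫ d² Zⁱⁱ dμ ≤ M ‖d‖²` in `L²`. -/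
theorem tensorRight_mem_closure_range (hreg : D.IsRegular) (hloc : D.IsStronglyLocal)
    (hΦU : range Φ.toMap ⊆ U) (i : Fin m) (c : D.core) :
    D.tensorRight (Φ.coord i) c ∈ closure (range (Φ.pullForm hreg hloc hΦU)) := by
  obtain ⟨M, hM0, hM⟩ : ∃ M : ℝ, 0 < M ∧ ∀ᵐ x ∂μ, Φ.Z i i x ≤ M := by
    have h := (Φ.memLp_top i i).eLpNorm_lt_top
    rw [eLpNorm_exponent_top] at h
    refine ⟨(eLpNormEssSup (Φ.Z i i) μ).toReal + 1, by positivity, ?_⟩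
    filter_upwards [enorm_ae_le_eLpNormEssSup (Φ.Z i i) μ] with x hx
    have h1 := ENNReal.toReal_mono h.ne hx
    rw [toReal_enorm] at h1
    linarith [le_abs_self (Φ.Z i i x), Real.norm_eq_abs (Φ.Z i i x)]
  rw [Metric.mem_closure_iff]
  intro ε hε
  obtain ⟨F, hF, g, hgF, hcg⟩ := Φ.dense c (ε ^ 2 / M) (by positivity)
  refine ⟨_, ⟨singleForm hF i, rfl⟩, ?_⟩
  have h1 : Φ.pullForm hreg hloc hΦU (singleForm hF i) = D.tensorRight (Φ.coord i) g.1 := by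
    rw [pullForm_apply, Finset.sum_eq_single i]
    · congr 1
      ext x
      rw [hgF x]
      simp only [pullCoeff_apply]
      change (EuclideanSpace.single i (F (Φ.toMap x)) : EuclideanSpace ℝ (Fin m)) i = _
      simp only [PiLp.single_apply, if_true]
      rfl
    · intro j _ hj
      have : Φ.pullCoeff hΦU (singleForm hF i) j = 0 := by
        ext x
        change (EuclideanSpace.single i (F (Φ.toMap x)) : EuclideanSpace ℝ (Fin m)) j = _
        simp [hj]
      rw [this, map_zero]
    · simp
  rw [h1, dist_eq_norm, ← map_sub]
  refine lt_of_pow_lt_pow_left₀ 2 hε.le ?_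
  rw [← real_inner_self_eq_norm_sq, Φ.inner_tensorRight hreg hloc]
  set d := c.1 - g.1 with hd
  have h2 : M * ‖toL2 μ d‖ ^ 2 < ε ^ 2 := by
    have := (norm_coreToDomain_sub_sq_le c g).trans_lt hcg
    rw [← map_sub, lt_div_iff₀ hM0] at this
    linarith
  refine lt_of_le_of_lt ?_ h2
  rw [← real_inner_self_eq_norm_sq, inner_toL2, ← integral_const_mul]
  refine integral_mono_ae (Φ.integrable_mul_Z (d * d) i i) ?_ ?_
  · exact ((d * d).continuous.integrable_of_hasCompactSupport
      (HasCompactSupport.of_compactSpace _)).const_mul M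
  · filter_upwards [hM] with x hx
    rw [mul_comm M]
    exact mul_le_mul_of_nonneg_left hx (mul_self_nonneg _)

theorem denseRange_pullForm (hreg : D.IsRegular) (hloc : D.IsStronglyLocal)
    (hΦU : range Φ.toMap ⊆ U) : DenseRange (Φ.pullForm hreg hloc hΦU) := by
  have hD := Φ.isConservative hloc
  set R := (LinearMap.range (Φ.pullForm hreg hloc hΦU).toLinearMap).topologicalClosure with hR
  have hRc : (R : Set D.Forms) = closure (range (Φ.pullForm hreg hloc hΦU)) := rfl
  have h0 : ∀ (i : Fin m) (f : C(K, ℝ)), D.tensorRight (Φ.coord i) f ∈ R := fun i f => by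
    refine hreg.denseRange.induction_on (p := fun f => D.tensorRight (Φ.coord i) f ∈ R) f ?_ ?_
    · exact (Submodule.isClosed_topologicalClosure _).preimage (D.tensorRight (Φ.coord i)).continuous
    · exact Φ.tensorRight_mem_closure_range hreg hloc hΦU i
  have h1 : ∀ a b : D.core, D.simpleTensor a b ∈ R := fun a b => by
    have hcl : D.simpleTensor a b ∈ closure (R : Set D.Forms) := by
      rw [Metric.mem_closure_iff]
      intro ε hε
      -- The first factor is approximated in energy by `F ∘ Φ`, whose tensor with `b` is expanded
      -- into coordinate tensors by the chain rule on all of `ℝᵐ`.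
      obtain ⟨F, hF, g, hgF, hag⟩ := Φ.dense a ((ε / (‖b.1‖ + 1)) ^ 2) (by positivity)
      have hF' : ContDiffOn ℝ 1 F univ := hF.contDiffOn
      refine ⟨D.simpleTensor g b, ?_, ?_⟩
      · rw [← tensorRight_coe hD hreg,
          tensorRight_chain hreg hloc isOpen_univ (subset_univ _) hF' g b hgF]
        exact Submodule.sum_mem _ fun i _ => h0 i _
      · have h2 : D.simpleTensor a b - D.simpleTensor g b = D.simpleTensor (a - g) b := by
          simp only [← toForms_tmul, ← map_sub, TensorProduct.sub_tmul]
        rw [dist_eq_norm, h2]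
        refine (hD.norm_simpleTensor_le _ _).trans_lt ?_
        have h3 : √(D.coreEnergy (a - g)) < ε / (‖b.1‖ + 1) := by
          rw [Real.sqrt_lt' (by positivity)]
          refine lt_of_le_of_lt ?_ hag
          rw [coreEnergy, energyOne, map_sub]
          exact le_add_of_nonneg_right (by positivity)
        rw [lt_div_iff₀ (by positivity)] at h3
        refine lt_of_le_of_lt ?_ h3
        gcongr
        linarith
    rwa [(Submodule.isClosed_topologicalClosure _).closure_eq] at hcl
  have h2 : ∀ x, D.toForms x ∈ R := fun x => by
    induction x with
    | zero => simp
    | tmul a b => exact h1 a b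
    | add x y hx hy => rw [map_add]; exact R.add_mem hx hy
  intro z
  rw [← hRc]
  exact denseRange_toForms.induction_on (p := fun z => z ∈ (R : Set D.Forms)) z
    (Submodule.isClosed_topologicalClosure _) h2

/-! ### Continuous forms as square integrable forms -/

variable (U) in
/-- The extension of a continuous form by zero. -/
noncomputable def extendForm (ω : CForms U) : EuclideanSpace ℝ (Fin m) → EuclideanSpace ℝ (Fin m) :=
  Function.extend Subtype.val ω 0

theorem extendForm_apply (ω : CForms U) {p : EuclideanSpace ℝ (Fin m)} (hp : p ∈ closure U) :
    extendForm U ω p = ω ⟨p, hp⟩ :=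
  Subtype.val_injective.extend_apply (f := (Subtype.val : closure U → _)) ω 0 ⟨p, hp⟩

theorem memLp_extendForm (ω : CForms U) (ν : Measure (EuclideanSpace ℝ (Fin m)))
    [IsFiniteMeasure ν] : MemLp (extendForm U ω) 2 ν := by
  have hmeas : Measurable (extendForm U ω) :=
    (MeasurableEmbedding.subtype_coe isClosed_closure.measurableSet).measurable_extend
      ω.continuous.measurable measurable_const
  refine MemLp.of_bound hmeas.aestronglyMeasurable ‖ω‖ (ae_of_all _ fun p => ?_)
  by_cases hp : p ∈ closure U
  · rw [extendForm_apply ω hp]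
    exact ω.norm_apply_le _
  · rw [extendForm, Function.extend_apply' _ _ _ (by rintro ⟨q, rfl⟩; exact hp q.2)]
    simp

/-- The class in `L²` of a continuous form. -/
noncomputable def formToL2 (ν : Measure (EuclideanSpace ℝ (Fin m))) [IsFiniteMeasure ν] :
    CForms U →ₗ[ℝ] Lp (EuclideanSpace ℝ (Fin m)) 2 ν where
  toFun ω := (memLp_extendForm ω ν).toLp
  map_add' ω η := by
    rw [← MemLp.toLp_add]
    congr 1
    have := Function.extend_add (Subtype.val : closure U → EuclideanSpace ℝ (Fin m)) ω η 0 0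
    rw [add_zero] at this
    exact this
  map_smul' c ω := by
    rw [RingHom.id_apply, ← MemLp.toLp_const_smul]
    congr 1
    have := Function.extend_smul c (Subtype.val : closure U → EuclideanSpace ℝ (Fin m)) ω 0
    rw [smul_zero] at this
    exact this

theorem ae_formToL2 (hΦU : range Φ.toMap ⊆ U) (ω : CForms U) :
    ∀ᵐ p ∂(μ.map Φ.toMap), ∀ hp : p ∈ range Φ.toMap,
      formToL2 (μ.map Φ.toMap) ω p = ω ⟨p, subset_closure (hΦU hp)⟩ := by
  filter_upwards [(memLp_extendForm ω (μ.map Φ.toMap)).coeFn_toLp] with p hp hpr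
  exact hp.trans (extendForm_apply ω _)

theorem denseRange_formToL2 (ν : Measure (EuclideanSpace ℝ (Fin m))) [IsFiniteMeasure ν]
    (hν : ∀ᵐ p ∂ν, p ∈ closure U) : DenseRange (formToL2 (U := U) ν) := by
  rw [Metric.denseRange_iff]
  intro v ε hε
  obtain ⟨g, hgc, hg, hgcont, hgm⟩ := (Lp.memLp v).exists_hasCompactSupport_eLpNorm_sub_le
    (by simp) (ε := ENNReal.ofReal (ε / 2)) (by simpa using hε)
  have hemb : IsClosedEmbedding (Subtype.val : closure U → EuclideanSpace ℝ (Fin m)) :=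
    isClosed_closure.isClosedEmbedding_subtypeVal
  let ω : CForms U := ⟨⟨fun p => g p, hgcont.comp continuous_subtype_val⟩,
    (hgc.comp_isClosedEmbedding hemb).is_zero_at_infty⟩
  have hω : formToL2 ν ω = hgm.toLp := by
    refine Lp.ext ?_
    filter_upwards [(memLp_extendForm ω ν).coeFn_toLp, hgm.coeFn_toLp, hν] with p h1 h2 h3
    rw [h2]
    exact h1.trans (extendForm_apply ω h3)
  refine ⟨ω, lt_of_le_of_lt ?_ (half_lt_self hε)⟩
  have h1 : v - hgm.toLp = ((Lp.memLp v).sub hgm).toLp := by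
    rw [MemLp.toLp_sub (Lp.memLp v) hgm, Lp.toLp_coeFn]
  rw [hω, dist_eq_norm, h1, Lp.norm_toLp]
  exact ENNReal.toReal_le_of_le_ofReal (by positivity) hg

/-- The projection of a continuous form to a square integrable section of the cotangent spaces. -/
noncomputable def formToL2Forms (U : Set (EuclideanSpace ℝ (Fin m))) :
    CForms U →ₗ[ℝ] L2Forms U (range Φ.toMap) (μ.map Φ.toMap) :=
  (L2Forms U (range Φ.toMap) (μ.map Φ.toMap)).orthogonalProjectionOnto.toLinearMap ∘ₗ
    formToL2 (μ.map Φ.toMap)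

theorem formToL2Forms_apply (ω : CForms U) : Φ.formToL2Forms U ω =
    (L2Forms U (range Φ.toMap) (μ.map Φ.toMap)).orthogonalProjectionOnto
      (formToL2 (μ.map Φ.toMap) ω) := rfl

/-- The global projection in `L²` changes `ω` only by a conormal field, so it represents the class
`[ω_p]` at almost every `p`. -/
theorem ae_sub_formToL2Forms_mem (hU : IsOpen U) (hΦU : range Φ.toMap ⊆ U) (ω : CForms U) :
    ∀ᵐ p ∂(μ.map Φ.toMap), ∀ hp : p ∈ range Φ.toMap, ω ⟨p, subset_closure (hΦU hp)⟩ -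
      (Φ.formToL2Forms U ω : Lp (EuclideanSpace ℝ (Fin m)) 2 (μ.map Φ.toMap)) p ∈
        dIdeal U (range Φ.toMap) p := by
  have h : formToL2 (μ.map Φ.toMap) ω -
      (Φ.formToL2Forms U ω : Lp (EuclideanSpace ℝ (Fin m)) 2 (μ.map Φ.toMap)) ∈
        conormalFields U (range Φ.toMap) (μ.map Φ.toMap) :=
    Φ.orthogonal_L2Forms_le hU hΦU (Submodule.sub_starProjection_mem_orthogonal _)
  rw [mem_conormalFields] at h
  filter_upwards [h, Φ.ae_formToL2 hΦU ω, Lp.coeFn_sub (formToL2 (μ.map Φ.toMap) ω)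
    (Φ.formToL2Forms U ω : Lp (EuclideanSpace ℝ (Fin m)) 2 (μ.map Φ.toMap))] with p h1 h2 h3 hp
  rw [h3, Pi.sub_apply, h2 hp] at h1
  exact h1

theorem formToL2Forms_eq_zero (hΦU : range Φ.toMap ⊆ U) (ω : CForms U)
    (hω : restrictForm hΦU ω = 0) : Φ.formToL2Forms U ω = 0 := by
  rw [formToL2Forms_apply]
  refine Submodule.orthogonalProjectionOnto_apply_of_mem_orthogonal
    (conormalFields_le_orthogonal ?_)
  rw [mem_conormalFields]
  filter_upwards [Φ.ae_formToL2 hΦU ω, Φ.ae_mem_range] with p h1 h2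
  rw [h1 h2]
  have := congr_fun hω ⟨p, h2⟩
  exact (Submodule.Quotient.mk_eq_zero _).1 this

theorem denseRange_formToL2Forms (hΦU : range Φ.toMap ⊆ U) : DenseRange (Φ.formToL2Forms U) := by
  have h1 : DenseRange (formToL2 (U := U) (μ.map Φ.toMap)) := by
    refine denseRange_formToL2 _ ?_
    filter_upwards [Φ.ae_mem_range] with p hp
    exact subset_closure (hΦU hp)
  have h2 : Function.Surjective
      (L2Forms U (range Φ.toMap) (μ.map Φ.toMap)).orthogonalProjectionOnto := fun v =>
    ⟨v, Submodule.orthogonalProjectionOnto_mem_subspace_eq_self v⟩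
  exact h2.denseRange.comp h1 (ContinuousLinearMap.continuous _)

/-- This is what makes `π` well defined on `L²` classes: equality almost everywhere modulo `d_p 𝓘`
already suffices. -/
theorem pullForm_eq_zero_of_formToL2Forms_eq_zero (hreg : D.IsRegular) (hloc : D.IsStronglyLocal)
    (hU : IsOpen U) (hΦU : range Φ.toMap ⊆ U) (ω : CForms U) (hω : Φ.formToL2Forms U ω = 0) :
    Φ.pullForm hreg hloc hΦU ω = 0 := by
  refine Φ.pullForm_eq_zero hreg hloc hU hΦU ω ?_
  have h := Φ.ae_sub_formToL2Forms_mem hU hΦU ω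
  rw [hω] at h
  have h1 : ∀ᵐ p ∂(μ.map Φ.toMap), ∀ hp : p ∈ range Φ.toMap,
      ω ⟨p, subset_closure (hΦU hp)⟩ ∈ dIdeal U (range Φ.toMap) p := by
    filter_upwards [h, Lp.coeFn_zero (EuclideanSpace ℝ (Fin m)) 2 (μ.map Φ.toMap)] with p h1 h2 hp
    have h3 := h1 hp
    rw [Submodule.coe_zero, h2] at h3
    simpa using h3
  filter_upwards [ae_of_ae_map Φ.continuous_toMap.aemeasurable h1] with y hy
  exact hy (mem_range_self y)

/-! ### The dual fields as square integrable forms -/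

/-- The densities live on `K`, whereas the adjoint takes values in fields on `K_Φ`;
`exists_comp_toMap_eq` moves each component there. -/
theorem exists_L2Forms_eq_dualField (hreg : D.IsRegular) (hloc : D.IsStronglyLocal)
    (hU : IsOpen U) (hΦU : range Φ.toMap ⊆ U) (b : Fin m → C(K, ℝ)) :
    ∃ w : L2Forms U (range Φ.toMap) (μ.map Φ.toMap),
      ∀ᵐ y ∂μ, (w : Lp (EuclideanSpace ℝ (Fin m)) 2 (μ.map Φ.toMap)) (Φ.toMap y) =
        Φ.dualField b y := by
  have hmem : ∀ j, MemLp (fun y => ∑ i, b i y * Φ.Z i j y) 2 μ := fun j =>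
    memLp_finsetSum _ fun i _ =>
      (Φ.memLp_two i j).mul (p := ∞) (ContinuousMap.memLp μ ℝ (b i))
  choose h hh hh' using fun j => Φ.exists_comp_toMap_eq hreg _ (hmem j)
  have hw : MemLp (fun p => ∑ j, h j p • (EuclideanSpace.single j 1 : EuclideanSpace ℝ (Fin m)))
      2 (μ.map Φ.toMap) :=
    memLp_finsetSum _ fun j _ => ((ContinuousLinearMap.id ℝ ℝ).smulRight
      (EuclideanSpace.single j 1 : EuclideanSpace ℝ (Fin m))).comp_memLp' (hh j)
  have hwy : ∀ᵐ y ∂μ, hw.toLp _ (Φ.toMap y) = Φ.dualField b y := by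
    filter_upwards [ae_all_iff.2 hh',
      ae_of_ae_map Φ.continuous_toMap.aemeasurable hw.coeFn_toLp] with y h1 h2
    rw [h2]
    ext k
    rw [dualField_apply, ← h1 k]
    simp [Pi.single_apply]
  refine ⟨⟨hw.toLp, Φ.mem_L2Forms_of_ae_inner_eq_zero hU hΦU _ fun f hf => ?_⟩, hwy⟩
  have hms : MeasurableSet {p | inner ℝ (gradient f p) (hw.toLp _ p) = 0} :=
    (measurable_gradient f).inner (Lp.stronglyMeasurable _).measurable (measurableSet_singleton 0)
  refine (ae_map_iff Φ.continuous_toMap.aemeasurable hms).2 ?_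
  filter_upwards [hwy, Φ.ae_dualField_mem_orthogonal hreg hloc hU hΦU] with y h1 h2
  have h3 : gradient f (Φ.toMap y) ∈ dIdeal U (range Φ.toMap) (Φ.toMap y) :=
    Submodule.subset_span ⟨f, hf.1, hf.2, rfl⟩
  rw [h1]
  exact Submodule.inner_right_of_mem_orthogonal h3 (h2 b)

/-- The adjoint identity. As `w` already lies in `L2Forms`, the projection drops out of the inner
product. -/
theorem inner_formToL2Forms (hreg : D.IsRegular) (hloc : D.IsStronglyLocal)
    (hΦU : range Φ.toMap ⊆ U) (b : Fin m → C(K, ℝ))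
    (w : L2Forms U (range Φ.toMap) (μ.map Φ.toMap))
    (hw : ∀ᵐ y ∂μ, (w : Lp (EuclideanSpace ℝ (Fin m)) 2 (μ.map Φ.toMap)) (Φ.toMap y) =
      Φ.dualField b y) (ω : CForms U) :
    inner ℝ w (Φ.formToL2Forms U ω) =
      inner ℝ (∑ i, D.tensorRight (Φ.coord i) (b i)) (Φ.pullForm hreg hloc hΦU ω) := by
  rw [formToL2Forms_apply, Submodule.inner_orthogonalProjectionOnto_eq_of_mem_left,
    inner_sum_tensorRight_pullForm, L2.inner_def, integral_map Φ.continuous_toMap.aemeasurable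
      ((Lp.aestronglyMeasurable _).inner (Lp.aestronglyMeasurable _))]
  refine integral_congr_ae ?_
  filter_upwards [hw, ae_of_ae_map Φ.continuous_toMap.aemeasurable (Φ.ae_formToL2 hΦU ω)]
    with y h1 h2
  rw [h1, h2 (mem_range_self y)]

end CoordinateSequence

/-! ### The operator on `L²` classes and its adjoint. -/

set_option maxHeartbeats 1000000 in
open DirichletForm in
theorem mainTheorem7 {K : Type*} [MetricSpace K] [LocallyCompactSpace K] [MeasurableSpace K]
    [BorelSpace K] (μ : Measure K) [μ.Regular] [μ.IsOpenPosMeasure]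
    (D : DirichletForm μ) (hreg : D.IsRegular) (hloc : D.IsStronglyLocal)
    {m : ℕ} (Φ : CoordinateSequence D m)
    (U : Set (EuclideanSpace ℝ (Fin m))) (hU : IsOpen U) (hΦU : range Φ.toMap ⊆ U) :
    -- the space `𝓗` and the elements `a ⊗ b` are well defined
    (∀ f ∈ D.core, ∀ g ∈ D.core, f * g ∈ D.core) ∧
    (∀ a b c d : D.core, inner ℝ (D.simpleTensor a b) (D.simpleTensor c d) =
      D.gammaIntegral a c (b.1 * d.1)) ∧
    (∀ (a : D.core) (b : C(K, ℝ)), (D.uniformApprox b).NeBot ∧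
      Tendsto (D.simpleTensor a) (D.uniformApprox b) (𝓝 (D.tensor a b))) ∧
    -- the map `π`
    ∃ π : CForms U →L[ℝ] D.Forms,
      (∀ ω : CForms U, π ω = ∑ i, D.tensor (Φ.coord i)
        (fun x => ω ⟨Φ.toMap x, subset_closure (hΦU (mem_range_self x))⟩ i)) ∧
      -- (1) the induced map on `Ω¹_C(U) / ker π` is injective with dense range
      (Function.Injective ((LinearMap.ker π.toLinearMap).liftQ π.toLinearMap le_rfl) ∧
        DenseRange ((LinearMap.ker π.toLinearMap).liftQ π.toLinearMap le_rfl)) ∧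
      -- (2) `π` descends to `Ω¹_C(K_Φ)`
      (LinearMap.ker (restrictForm hΦU) ≤ LinearMap.ker π.toLinearMap ∧
        ∃ π' : CFormsOn hΦU →ₗ[ℝ] D.Forms,
          ∀ ω : CForms U, π' ⟨restrictForm hΦU ω, LinearMap.mem_range_self _ ω⟩ =
            ∑ i, D.tensor (Φ.coord i)
              (fun x => ω ⟨Φ.toMap x, subset_closure (hΦU (mem_range_self x))⟩ i)) ∧
      -- (3) the natural map `j : Ω¹_C(K_Φ) → Ω¹_{L²}(K_Φ)`, and `π` as an operator `T` on `L²` forms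
      ∃ j : CFormsOn hΦU →ₗ[ℝ] L2Forms U (range Φ.toMap) (μ.map Φ.toMap),
        (∀ s : CFormsOn hΦU, ∀ᵐ p ∂(μ.map Φ.toMap), ∀ hp : p ∈ range Φ.toMap,
          (Submodule.Quotient.mk ((j s : Lp (EuclideanSpace ℝ (Fin m)) 2 (μ.map Φ.toMap)) p) :
            CotangentSpace U (range Φ.toMap) p) = s.1 ⟨p, hp⟩) ∧
        ∃ T : L2Forms U (range Φ.toMap) (μ.map Φ.toMap) →ₗ.[ℝ] D.Forms,
          T.domain = LinearMap.range j ∧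
          (∀ (ω : CForms U) (v : T.domain),
            (v : L2Forms U (range Φ.toMap) (μ.map Φ.toMap)) =
              j ⟨restrictForm hΦU ω, LinearMap.mem_range_self _ ω⟩ → T v = π ω) ∧
          Dense (T.domain : Set (L2Forms U (range Φ.toMap) (μ.map Φ.toMap))) ∧
          T.IsClosable ∧
          ∀ b : Fin m → C(K, ℝ),
            ∃ h : ∑ i, D.tensor (Φ.coord i) (b i) ∈ T.adjoint.domain,
              ∀ᵐ y ∂μ, (Submodule.Quotient.mk
                  ((T.adjoint ⟨_, h⟩ : Lp (EuclideanSpace ℝ (Fin m)) 2 (μ.map Φ.toMap))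
                    (Φ.toMap y)) :
                  CotangentSpace U (range Φ.toMap) (Φ.toMap y)) =
                Submodule.Quotient.mk (∑ i, ∑ j, (Φ.Z i j y * b i y) •
                  EuclideanSpace.single j (1 : ℝ)) := by
  have : CompactSpace K := Φ.compactSpace
  have hD := Φ.isConservative hloc
  set π := Φ.pullForm hreg hloc hΦU with hπ
  have hker : LinearMap.ker (restrictForm hΦU) ≤ LinearMap.ker π.toLinearMap := fun ω hω =>
    Φ.pullForm_eq_zero_of_formToL2Forms_eq_zero hreg hloc hU hΦU ω
      (Φ.formToL2Forms_eq_zero hΦU ω hω)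
  obtain ⟨π', hπ'⟩ := LinearMap.exists_range_lift (restrictForm hΦU) π.toLinearMap hker
  obtain ⟨j, hj⟩ := LinearMap.exists_range_lift (restrictForm hΦU) (Φ.formToL2Forms U)
    fun ω hω => Φ.formToL2Forms_eq_zero hΦU ω hω
  -- Sections may differ and yet agree almost everywhere, so `j` need not be injective; `π'` still
  -- factors through its range.
  obtain ⟨T, hT⟩ := LinearMap.exists_range_lift j π' (by
    rintro ⟨_, ω, rfl⟩ hω
    rw [LinearMap.mem_ker] at hω ⊢
    rw [hj] at hω
    rw [hπ']
    exact Φ.pullForm_eq_zero_of_formToL2Forms_eq_zero hreg hloc hU hΦU ω hω)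
  have hdense : Dense (LinearMap.range j : Set (L2Forms U (range Φ.toMap) (μ.map Φ.toMap))) := by
    refine (Φ.denseRange_formToL2Forms hΦU).mono ?_
    rintro _ ⟨ω, rfl⟩
    exact ⟨_, hj ω⟩
  let S : L2Forms U (range Φ.toMap) (μ.map Φ.toMap) →ₗ.[ℝ] D.Forms := ⟨LinearMap.range j, T⟩
  have hadj : ∀ (b : Fin m → C(K, ℝ)) (w : L2Forms U (range Φ.toMap) (μ.map Φ.toMap)),
      (∀ᵐ y ∂μ, (w : Lp (EuclideanSpace ℝ (Fin m)) 2 (μ.map Φ.toMap)) (Φ.toMap y) =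
        Φ.dualField b y) →
      ∀ x : S.domain, inner ℝ w (x : L2Forms U (range Φ.toMap) (μ.map Φ.toMap)) =
        inner ℝ (∑ i, D.tensorRight (Φ.coord i) (b i)) (S x) := by
    rintro b w hw ⟨_, ⟨_, ω, rfl⟩, rfl⟩
    refine Eq.trans ?_ ((Φ.inner_formToL2Forms hreg hloc hΦU b w hw ω).trans ?_)
    · rw [← hj]
    · exact congrArg _ ((hπ' ω).symm.trans (hT _).symm)
  have hdom : ∀ b : Fin m → C(K, ℝ),
      ∑ i, D.tensorRight (Φ.coord i) (b i) ∈ S.adjoint.domain := fun b => by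
    obtain ⟨w, hw⟩ := Φ.exists_L2Forms_eq_dualField hreg hloc hU hΦU b
    exact (LinearPMap.exists_adjoint_eq hdense (hadj b w hw)).1
  refine ⟨fun f hf g hg => hD.mul_mem_core hf hg, hD.inner_simpleTensor, fun a b =>
    ⟨hreg.neBot_uniformApprox b, ?_⟩, π, Φ.pullForm_eq_sum_tensor hreg hloc hΦU, ⟨?_, ?_⟩,
    ⟨hker, π', fun ω => ?_⟩, j, ?_, S, rfl, ?_, hdense, ?_, fun b => ?_⟩
  · rw [tensor_eq hD hreg]
    exact tendsto_simpleTensor hD hreg a b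
  · rw [← LinearMap.ker_eq_bot, Submodule.ker_liftQ_eq_bot _ _ _ le_rfl]
  · refine (Φ.denseRange_pullForm hreg hloc hΦU).mono ?_
    rintro _ ⟨ω, rfl⟩
    exact ⟨Submodule.Quotient.mk ω, rfl⟩
  · rw [hπ']
    exact Φ.pullForm_eq_sum_tensor hreg hloc hΦU ω
  · rintro ⟨_, ω, rfl⟩
    rw [hj]
    filter_upwards [Φ.ae_sub_formToL2Forms_mem hU hΦU ω] with p h1 hp
    exact ((Submodule.Quotient.eq _).2 (h1 hp)).symm
  · rintro ω ⟨v, hv⟩ (rfl : v = _)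
    exact (hT _).trans (hπ' ω)
  -- The domain of the adjoint contains the range of `π`, which is dense.
  · refine S.isClosable_of_dense_adjoint_domain hdense
      ((Φ.denseRange_pullForm hreg hloc hΦU).mono ?_)
    rintro _ ⟨ω, rfl⟩
    exact hdom _
  · simp only [tensor_eq hD hreg]
    obtain ⟨w, hw⟩ := Φ.exists_L2Forms_eq_dualField hreg hloc hU hΦU b
    obtain ⟨h1, h2⟩ := LinearPMap.exists_adjoint_eq hdense (hadj b w hw)
    refine ⟨h1, ?_⟩
    filter_upwards [hw] with y hy
    rw [h2, hy, Φ.dualField_eq]
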